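/- Let $p$ be a prime and let $S/R$ be a finite extension of discrete valuation rings of characteristic $p$ (so $R\subseteq S$ and $S$ is a finitely generated $R$-module), with fields of fractions $K=\operatorname{Frac}R$ and $L=\operatorname{Frac}S$. Let $n=[L:K]$, let $v_L$ be the normalised discrete valuation on $L$ associated to $S$ (so $v_L(L^\times)=\mathbb{Z}$), and let $w=v_L(\mathcal{D}_{S/R})$, where the different $\mathcal{D}_{S/R}$ is the ideal of $S$ with $\mathcal{D}_{S/R}^{-1}=\{x\in L\mid \mathrm{Tr}_{L/K}(xS)\subseteq R\}$. Suppose that $L/K$ is separable and is $H$-Galois for some $K$-Hopf algebra $H$; that is, $L$ is an $H$-module algebra and the $L$-linear map $L\otimes_K H\to \mathrm{End}_K(L)$, $l\otimes h\mapsto (x\mapsto l\,(h\cdot x))$, is bijective. Call $\rho\in L$ a normal basis generator for $L/K$ with respect to $H$ if $L$ is a free $H$-module with generator $\rho$, i.e. if $h\mapsto h\cdot\rho$ is a bijection $H\to L$. Let $b\in\mathbb{Z}$. (a) If $L/K$ is totally ramified (the ramification index of $S/R$ is $n$), $n=p^m$ for some integer $m\ge 0$, and $b\equiv -w-1 \pmod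 n$, then every $\rho\in L$ with $v_L(\rho)=b$ is a normal basis generator for $L/K$ with respect to $H$. (b) This is best possible: if (i) $n$ is not of the form $p^m$ with $m\ge 0$, or (ii) $L/K$ is not totally ramified, or (iii) $b\not\equiv -w-1\pmod n$, then there is some $\rho\in L$ with $v_L(\rho)=b$ which is not a normal basis generator for $L/K$ with respect to $H$. -/

import Mathlib

open scoped TensorProduct nonZeroDivisors

noncomputable section

/-- The evaluation map `h ↦ h • x` of a `K`-linear action of `H` on `L`. -/
def hopfEval (K : Type*) {L : Type*} (H : Type*) [Field K] [Field L] [Algebra K L]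
    [Ring H] [Algebra K H] [Module H L] [IsScalarTower K H L] (x : L) : H →ₗ[K] L :=
  (LinearMap.toSpanSingleton H L x).restrictScalars K

/-- `L` is an `H`-module algebra: the unit and the multiplication of `L` are compatible with the
counit and the comultiplication of `H`, that is, `h • 1 = ε(h) 1` and
`h • (x y) = ∑ (h₁ • x) (h₂ • y)`. -/
structure IsHopfModuleAlgebra (K L H : Type*) [Field K] [Field L] [Algebra K L]
    [Ring H] [HopfAlgebra K H] [Module H L] [IsScalarTower K H L] : Prop where
  smul_one : ∀ h : H, h • (1 : L) = algebraMap K L (Coalgebra.counit (R := K) h)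
  smul_mul : ∀ (h : H) (x y : L),
    h • (x * y) = LinearMap.mul' K L
      (TensorProduct.map (hopfEval K H x) (hopfEval K H y) (Coalgebra.comul (R := K) h))

/-- The map `L ⊗ H → End_K(L)`, `l ⊗ h ↦ (x ↦ l (h • x))`. -/
def hopfGaloisMap (K L H : Type*) [Field K] [Field L] [Algebra K L]
    [Ring H] [Algebra K H] [Module H L] [IsScalarTower K H L] :
    L ⊗[K] H →ₗ[K] Module.End K L :=
  TensorProduct.lift <|
    ((LinearMap.mul K (Module.End K L)).comp (LinearMap.mul K L)).compl₂
      (Algebra.lsmul K K L : H →ₐ[K] Module.End K L).toLinearMap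

/-- `L/K` is `H`-Galois: `L` is an `H`-module algebra, and the action of `H` extends to a bijection
`L ⊗ H → End_K(L)`. -/
structure IsHopfGalois (K L H : Type*) [Field K] [Field L] [Algebra K L]
    [Ring H] [HopfAlgebra K H] [Module H L] [IsScalarTower K H L] : Prop where
  moduleAlgebra : IsHopfModuleAlgebra K L H
  bijective : Function.Bijective (hopfGaloisMap K L H)

/-- `ρ` is a normal basis generator of `L` with respect to `H`: a free generator of the
`H`-module `L`. -/
def IsNormalBasisGenerator {L : Type*} (H : Type*) [Field L] [Ring H] [Module H L] (ρ : L) : Prop :=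
  Function.Bijective (fun h : H => h • ρ)

/-- `v_L(ρ) = b`, where `v_L` is the normalised additive valuation on `L = Frac S` attached to the
discrete valuation ring `S`. Mathlib's multiplicative valuation is `exp (-v_L)`. -/
def HasValuation (S : Type*) {L : Type*} [CommRing S] [IsDomain S] [IsDiscreteValuationRing S]
    [Field L] [Algebra S L] [IsFractionRing S L] (ρ : L) (b : ℤ) : Prop :=
  (IsDiscreteValuationRing.maximalIdeal S).valuation L ρ = WithZero.exp (-b)

/-- `v_L(𝔇_{S/R})`: the exponent of the maximal ideal of `S` in the different of `S/R`. -/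
def differentValuation (R S L : Type*) [CommRing R] [IsDomain R] [IsDiscreteValuationRing R]
    [CommRing S] [IsDomain S] [IsDiscreteValuationRing S]
    [Algebra R S] [Module.IsTorsionFree R S]
    [Field L] [Algebra S L] [IsFractionRing S L] : ℤ :=
  FractionalIdeal.count L (IsDiscreteValuationRing.maximalIdeal S)
    (differentIdeal R S : FractionalIdeal S⁰ L)

/-- `S/R` is totally ramified: its ramification index is the degree `[L : K]`. -/
def IsTotallyRamified (R S K L : Type*) [CommRing R] [IsLocalRing R] [CommRing S] [IsLocalRing S]
    [Algebra R S] [Field K] [Field L] [Algebra K L] : Prop :=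
  Ideal.ramificationIdx' (IsLocalRing.maximalIdeal R) (IsLocalRing.maximalIdeal S)
    = Module.finrank K L

end

/-!
Write `v` for Mathlib's multiplicative valuation of `L`, `w` for the exponent of the different and
`n` for the degree. The inverse different is `{x | v x ≤ exp w}`. What is used of `S/R` is this, the
value group of `K` (`IsTraceValuation`), and whether the residue fields agree.

**The trace.** Let `Ω` be an algebraic closure of `K`. By the Galois condition, evaluation at an
embedding `ι : L → Ω` identifies `Ω ⊗ H` with the dual of `Ω ⊗ L`. The other embeddings form a basis
of that dual, and since they are multiplicative they correspond to grouplike elements. Hence `Ω ⊗ H`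
is the group algebra of a group `G` of order `n`, and the sum of `G` acts on `L` as the trace. An
element of trace zero is therefore never a generator
(`not_isNormalBasisGenerator_of_trace_eq_zero`). If `n` is a power of `p`, then `G` is a `p`-group in
characteristic `p`, so that every nonzero left ideal of the group algebra contains the sum of `G`,
and every element of nonzero trace is a generator (`isNormalBasisGenerator_of_trace_ne_zero`).

**Valuations and the trace.** If the residue fields agree, an element `ρ` with `v ρ = exp i` and
`i ≡ w + 1` modulo the ramification index has nonzero trace (`IsTraceValuation.trace_ne_zero`): after
scaling, `i = w + 1`, and `Tr ρ = 0` would give `Tr (ρ S) = Tr (ρ 𝔪) ⊆ R`, whereas `ρ` is not in the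
inverse different. In every other class of valuations there are elements of trace zero, since an
integral trace can be cancelled by a small element of trace one
(`IsTraceValuation.exists_trace_eq_zero_of_not_modEq`). An element of `S` whose residue class does
not come from `R` provides elements of trace zero of every valuation
(`IsTraceValuation.exists_trace_eq_zero_of_residue`).

**Degrees which are not powers of `p`.** What remains is a totally ramified extension whose degree is
divisible by a prime `q ≠ p`, in the critical class `w + 1`; there the trace never vanishes. Consider
the sum of the simple `Ω ⊗ H`-submodules of `Ω ⊗ L` other than `Ω ⬝ 1`. It does not contain `1`, as
the trivial representation occurs only once in the socle of the regular representation, and it is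
nonzero because `G` is not a `p`-group. It is stable under the automorphisms of `Ω` and under the
Frobenius map of `Ω ⊗ L`, both of which permute the submodules, and so it contains a nonzero element
of `L` (`exists_tmul_mem_hopfSocle`). Its intersection `W` with `L` is a nonzero `H`-stable subspace.
An element orthogonal to `W` for the trace form is not a generator
(`exists_frobenius_stable_submodule`). Since `W` is stable under `x ↦ x ^ p` and does not contain `1`,
it has no element of valuation `0`: powers of `1 + u` with `v u < 1` would converge to `1`
(`IsTraceValuation.valuation_ne_one`). A subspace of dimension `d` takes at least `d` classes of
valuations modulo `n`, and `c ↦ w + 1 - c` maps the classes of `W` off those of its orthogonal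
complement; by counting, the complement contains elements of the critical class
(`IsTraceValuation.exists_trace_mul_eq_zero`).
-/


/-! ### Discrete valuations and the trace -/

/-- The trace of `L/K` as seen by a discrete valuation `v` of `L` (written multiplicatively): `v` is
onto, its restriction to `K` has image generated by `exp (-e)`, and the largest fractional ideal with
integral trace, the inverse different, is `{x | v x ≤ exp w}`. -/
structure IsTraceValuation (K : Type*) {L : Type*} [Field K] [Field L] [Algebra K L]
    (v : Valuation L (WithZero (Multiplicative ℤ))) (e w : ℤ) : Prop where
  surjective : ∀ i : ℤ, ∃ x, v x = WithZero.exp i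
  pos : 0 < e
  exists_uniformizer : ∃ t : K, v (algebraMap K L t) = WithZero.exp (-e)
  exists_valuation_algebraMap : ∀ x : K, x ≠ 0 → ∃ j : ℤ, v (algebraMap K L x) = WithZero.exp (e * j)
  le_exp_iff : ∀ x : L, v x ≤ WithZero.exp w ↔
    ∀ y, v y ≤ 1 → v (algebraMap K L (Algebra.trace K L (x * y))) ≤ 1

section
open WithZero

variable {K L : Type*} [Field K] [Field L] [Algebra K L]
  {v : Valuation L (WithZero (Multiplicative ℤ))} {e w : ℤ}

lemma exists_valuation_eq_exp {x : L} (hx : x ≠ 0) : ∃ i : ℤ, v x = exp i :=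
  ⟨log (v x), (exp_log ((Valuation.ne_zero_iff _).2 hx)).symm⟩

lemma valuation_le_exp_neg_one {x : L} (hx : v x < 1) : v x ≤ exp (-1) := by
  rw [← WithZero.lt_mul_exp_iff_le (by simp), ← exp_add]
  simpa using hx

namespace IsTraceValuation

section
variable (h : IsTraceValuation K v e w)
include h

lemma exists_scalar (j : ℤ) : ∃ a : K, v (algebraMap K L a) = exp (e * j) := by
  obtain ⟨t, ht⟩ := h.exists_uniformizer
  refine ⟨t ^ (-j), ?_⟩
  rw [map_zpow₀, map_zpow₀, ht, ← exp_zsmul]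
  congr 1
  simp only [smul_eq_mul]; ring

lemma trace_le_one {z : L} (hz : v z ≤ exp w) : v (algebraMap K L (Algebra.trace K L z)) ≤ 1 := by
  simpa using (h.le_exp_iff z).1 hz 1 (by simp)

lemma trace_le_exp {z : L} (j : ℤ) (hz : v z ≤ exp (w + e * j)) :
    v (algebraMap K L (Algebra.trace K L z)) ≤ exp (e * j) := by
  obtain ⟨a, ha⟩ := h.exists_scalar (-j)
  have h1 := h.trace_le_one (z := a • z) (by
    rw [Algebra.smul_def, map_mul, ha]
    calc _ ≤ exp (e * -j) * exp (w + e * j) := by gcongr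
      _ = exp w := by rw [← exp_add]; congr 1; ring)
  rw [map_smul, smul_eq_mul, map_mul, map_mul, ha] at h1
  calc _ = exp (e * j) * (exp (e * -j) * v (algebraMap K L (Algebra.trace K L z))) := by
        rw [← mul_assoc, ← exp_add]; simp
    _ ≤ exp (e * j) * 1 := by gcongr
    _ = _ := mul_one _

lemma exists_trace_eq_one {c : ℤ} (hc : w - e < c) :
    ∃ z : L, v z ≤ exp c ∧ Algebra.trace K L z = 1 := by
  obtain ⟨x, hx⟩ := h.surjective (c + e)
  have h1 : ¬ v x ≤ exp w := by rw [hx, exp_le_exp]; lia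
  rw [h.le_exp_iff] at h1
  push Not at h1
  obtain ⟨y, hy, hxy⟩ := h1
  have h0 : Algebra.trace K L (x * y) ≠ 0 := by rintro h0; simp [h0] at hxy
  obtain ⟨j, hj⟩ := h.exists_valuation_algebraMap _ h0
  rw [hj, ← exp_zero, exp_lt_exp] at hxy
  have hj1 : 1 ≤ j := by
    by_contra hcon
    nlinarith [h.pos]
  refine ⟨(Algebra.trace K L (x * y))⁻¹ • (x * y), ?_, ?_⟩
  · rw [Algebra.smul_def, map_mul, map_inv₀, map_inv₀, hj, map_mul, hx]
    calc (exp (e * j))⁻¹ * (exp (c + e) * v y) ≤ (exp (e * j))⁻¹ * (exp (c + e) * 1) := by gcongr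
      _ = exp (c + e - e * j) := by rw [mul_one, ← exp_neg, ← exp_add]; congr 1; ring
      _ ≤ exp c := by rw [exp_le_exp]; nlinarith [h.pos]
  · rw [map_smul, smul_eq_mul, inv_mul_cancel₀ h0]

/-- An integral trace of `ρ` can be cancelled without changing the valuation, by an element of trace
`1` which is closer to zero than `ρ`. -/
lemma exists_trace_eq_zero_of_trace_le {i : ℤ} (hi : w - e < i - 1) {ρ : L} (hρ : v ρ = exp i)
    (hT : v (algebraMap K L (Algebra.trace K L ρ)) ≤ 1) :
    ∃ ρ : L, v ρ = exp i ∧ Algebra.trace K L ρ = 0 := by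
  obtain ⟨z, hz, hz1⟩ := h.exists_trace_eq_one hi
  refine ⟨ρ - Algebra.trace K L ρ • z, ?_, by simp [hz1]⟩
  rw [Valuation.map_sub_eq_of_lt_left, hρ]
  rw [hρ, Algebra.smul_def, map_mul]
  calc _ ≤ 1 * exp (i - 1) := by gcongr
    _ < exp i := by rw [one_mul, exp_lt_exp]; lia

lemma exists_trace_eq_zero_of_scaled {i i' : ℤ} (hi : i ≡ i' [ZMOD e])
    (H : ∃ ρ : L, v ρ = exp i' ∧ Algebra.trace K L ρ = 0) :
    ∃ ρ : L, v ρ = exp i ∧ Algebra.trace K L ρ = 0 := by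
  obtain ⟨j, hj⟩ := hi.symm.dvd
  obtain ⟨a, ha⟩ := h.exists_scalar j
  obtain ⟨ρ, h1, h2⟩ := H
  refine ⟨a • ρ, ?_, by simp [h2]⟩
  rw [Algebra.smul_def, map_mul, ha, h1, ← exp_add, ← hj]; congr 1; ring

theorem exists_trace_eq_zero_of_not_modEq {i : ℤ} (hi : ¬ i ≡ w + 1 [ZMOD e]) :
    ∃ ρ : L, v ρ = exp i ∧ Algebra.trace K L ρ = 0 := by
  -- the representative of `i` modulo `e` in the interval `(w - e, w]`
  set i' := w - (w - i) % e with hi'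
  have hm : i ≡ i' [ZMOD e] := by
    refine (Int.modEq_iff_dvd.2 ?_)
    have := Int.emod_add_mul_ediv (w - i) e
    exact ⟨(w - i) / e, by rw [hi']; lia⟩
  have h0 := Int.emod_nonneg (w - i) h.pos.ne'
  have h1 := Int.emod_lt_of_pos (w - i) h.pos
  have h2 : i' ≠ w + 1 - e := by
    intro h2
    exact hi (hm.trans (by rw [h2]; exact Int.modEq_iff_dvd.2 ⟨1, by ring⟩))
  obtain ⟨ρ, hρ⟩ := h.surjective i'
  refine h.exists_trace_eq_zero_of_scaled hm
    (h.exists_trace_eq_zero_of_trace_le (by lia) hρ (h.trace_le_one ?_))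
  rw [hρ, exp_le_exp]; lia

/-- A residue class of `L` which does not come from `K` yields elements of trace zero of every
valuation. -/
theorem exists_trace_eq_zero_of_residue {s : L} (hs1 : v s ≤ 1)
    (hs : ∀ r : K, v (algebraMap K L r) ≤ 1 → v (s - algebraMap K L r) = 1) (i : ℤ) :
    ∃ ρ : L, v ρ = exp i ∧ Algebra.trace K L ρ = 0 := by
  by_cases hi : i ≡ w + 1 [ZMOD e]
  swap
  · exact h.exists_trace_eq_zero_of_not_modEq hi
  refine h.exists_trace_eq_zero_of_scaled hi ?_
  obtain ⟨ρ, hρ⟩ := h.surjective (w + 1)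
  by_cases hT : v (algebraMap K L (Algebra.trace K L ρ)) ≤ 1
  · exact h.exists_trace_eq_zero_of_trace_le (by linarith [h.pos]) hρ hT
  have h0 : Algebra.trace K L ρ ≠ 0 := by rintro h0; simp [h0] at hT
  have hsT : v (algebraMap K L (Algebra.trace K L (s * ρ))) ≤
      v (algebraMap K L (Algebra.trace K L ρ)) := by
    obtain ⟨j, hj⟩ := h.exists_valuation_algebraMap _ h0
    rw [hj, ← exp_zero, exp_le_exp, not_le] at hT
    have hj1 : 1 ≤ j := by
      by_contra hcon
      nlinarith [h.pos]
    rw [hj]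
    apply h.trace_le_exp
    rw [map_mul, hρ]
    calc _ ≤ 1 * exp (w + 1) := by gcongr
      _ ≤ _ := by rw [one_mul, exp_le_exp]; nlinarith [h.pos]
  refine ⟨s * ρ - (Algebra.trace K L (s * ρ) / Algebra.trace K L ρ) • ρ, ?_, ?_⟩
  · rw [Algebra.smul_def, ← sub_mul, map_mul, hs, hρ, one_mul]
    rw [map_div₀, map_div₀]
    exact div_le_one_of_le₀ hsT zero_le
  · rw [map_sub, map_smul, smul_eq_mul, div_mul_cancel₀ _ h0, sub_self]

/-- With trivial residue field extension, elements with valuation in the critical class modulo `e`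
have nonzero trace: otherwise the inverse different would be larger than it is. -/
theorem trace_ne_zero
    (hres : ∀ x : L, v x ≤ 1 → ∃ r : K, v (algebraMap K L r) ≤ 1 ∧ v (x - algebraMap K L r) < 1)
    {i : ℤ} (hi : i ≡ w + 1 [ZMOD e]) {ρ : L} (hρ : v ρ = exp i) : Algebra.trace K L ρ ≠ 0 := by
  intro h0
  obtain ⟨j, hj⟩ := hi.dvd
  obtain ⟨a, ha⟩ := h.exists_scalar j
  have hρ' : v (a • ρ) = exp (w + 1) := by
    rw [Algebra.smul_def, map_mul, ha, hρ, ← exp_add, ← hj]; congr 1; ring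
  have h1 : ¬ v (a • ρ) ≤ exp w := by rw [hρ', exp_le_exp]; lia
  rw [h.le_exp_iff] at h1
  push Not at h1
  obtain ⟨y, hy, hy1⟩ := h1
  obtain ⟨r, -, hr⟩ := hres y hy
  refine hy1.not_ge ?_
  have : Algebra.trace K L (a • ρ * y) = Algebra.trace K L (a • ρ * (y - algebraMap K L r)) := by
    rw [mul_sub, map_sub, mul_comm _ (algebraMap K L r), ← Algebra.smul_def]
    simp [h0]
  rw [this]
  apply h.trace_le_one
  rw [map_mul, hρ']
  have : v (y - algebraMap K L r) ≤ exp (-1) := valuation_le_exp_neg_one hr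
  calc _ ≤ exp (w + 1) * exp (-1) := by gcongr
    _ = exp w := by rw [← exp_add]; congr 1; ring
end
end IsTraceValuation
end

/-! ### Valuations on subspaces and the orthogonal complement -/

section
open WithZero

variable {K L : Type*} [Field K] [Field L] [Algebra K L]
  {v : Valuation L (WithZero (Multiplicative ℤ))} {w : ℤ}

lemma exists_valuation_sum_eq {ι : Type*} (s : Finset ι) (hs : s.Nonempty) (x : ι → L)
    (hx : ∀ i ∈ s, ∀ j ∈ s, v (x i) = v (x j) → i = j) : ∃ i ∈ s, v (∑ i ∈ s, x i) = v (x i) := by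
  classical
  induction hs using Finset.Nonempty.cons_induction with
  | singleton a => exact ⟨a, by simp⟩
  | cons a s ha hs ih =>
    obtain ⟨i, hi, hv⟩ := ih fun i hi j hj => hx i (by simp [hi]) j (by simp [hj])
    have hne : v (x a) ≠ v (∑ i ∈ s, x i) := by
      rw [hv]
      intro h
      exact ha (hx a (by simp) i (by simp [hi]) h ▸ hi)
    rw [Finset.sum_cons, Valuation.map_add_of_distinct_val _ hne]
    rcases max_choice (v (x a)) (v (∑ i ∈ s, x i)) with h | h
    · exact ⟨a, by simp, h⟩
    · exact ⟨i, by simp [hi], h.trans hv⟩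

open Classical in
/-- The classes modulo `n` of the exponents of the nonzero elements of a subspace of `L`. -/
noncomputable def valuationClasses (v : Valuation L (WithZero (Multiplicative ℤ))) (n : ℕ) [NeZero n]
    (W : Submodule K L) : Finset (ZMod n) :=
  {c | ∃ x ∈ W, ∃ i : ℤ, v x = exp i ∧ (i : ZMod n) = c}

lemma mem_valuationClasses {n : ℕ} [NeZero n] {W : Submodule K L} {c : ZMod n} :
    c ∈ valuationClasses v n W ↔ ∃ x ∈ W, ∃ i : ℤ, v x = exp i ∧ (i : ZMod n) = c := by
  simp [valuationClasses]

namespace IsTraceValuation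

section
variable {n : ℕ} (h : IsTraceValuation K v n w)
include h

lemma exists_exp_of_smul {a : K} {x : L} {i : ℤ} (hx : v x = exp i) (ha : a ≠ 0) :
    ∃ k : ℤ, v (a • x) = exp k ∧ (k : ZMod n) = i := by
  obtain ⟨j, hj⟩ := h.exists_valuation_algebraMap a ha
  exact ⟨n * j + i, by rw [Algebra.smul_def, map_mul, hj, hx, ← exp_add], by simp⟩

lemma exists_valuation_sum_smul {ι : Type*} [Fintype ι] (x : ι → L) (i : ι → ℤ)
    (hx : ∀ k, v (x k) = exp (i k)) (hi : Function.Injective fun k => (i k : ZMod n))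
    {a : ι → K} (ha : a ≠ 0) :
    ∃ k, ∃ j : ℤ, v (∑ k, a k • x k) = exp j ∧ (j : ZMod n) = i k := by
  classical
  set s : Finset ι := Finset.univ.filter fun k => a k ≠ 0 with hs
  have hsn : s.Nonempty := by
    obtain ⟨k, hk⟩ := Function.ne_iff.1 ha
    exact ⟨k, by simpa [hs] using hk⟩
  have hex : ∀ k ∈ s, ∃ j : ℤ, v (a k • x k) = exp j ∧ (j : ZMod n) = i k := fun k hk =>
    h.exists_exp_of_smul (hx k) (by simpa [hs] using hk)
  obtain ⟨k, hk, hv⟩ := exists_valuation_sum_eq (v := v) s hsn (x := fun k => a k • x k) (by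
    intro k hk l hl hkl
    obtain ⟨j, hj, hj'⟩ := hex k hk
    obtain ⟨j₂, hj₂, hj₂'⟩ := hex l hl
    rw [hj, hj₂, exp_inj] at hkl
    exact hi (by simp [← hj', ← hj₂', hkl]))
  obtain ⟨j, hj, hj'⟩ := hex k hk
  refine ⟨k, j, ?_, hj'⟩
  rw [← hj, ← hv]
  refine congrArg v (Finset.sum_subset (Finset.subset_univ s) fun l _ hl => ?_).symm
  have : a l = 0 := by simpa [hs] using hl
  simp [this]

/-- In the totally ramified case the elements of a subspace of dimension `d` fall into at least `d`
classes: a complement of the classes of `W` is represented by independent elements whose span meets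
`W` trivially. -/
lemma finrank_le_card_valuationClasses [NeZero n] [FiniteDimensional K L]
    (hn : Module.finrank K L = n) (W : Submodule K L) :
    Module.finrank K W ≤ (valuationClasses v n W).card := by
  classical
  obtain ⟨D, hD⟩ : ∃ D, D = (valuationClasses v n W)ᶜ := ⟨_, rfl⟩
  choose r hr using fun c : D => ZMod.intCast_surjective (c : ZMod n)
  choose u hu using fun c : D => h.surjective (r c)
  have hinj : Function.Injective fun c => (r c : ZMod n) := by
    intro c d hcd
    exact Subtype.ext ((hr c).symm.trans (hcd.trans (hr d)))
  have hind : LinearIndependent K u := by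
    rw [Fintype.linearIndependent_iff]
    intro a ha
    by_contra hcon
    obtain ⟨k, j, hj, -⟩ := h.exists_valuation_sum_smul u r hu hinj (a := a) (by
      rintro rfl; simp at hcon)
    rw [ha, map_zero] at hj
    exact exp_ne_zero hj.symm
  have hdisj : W ⊓ Submodule.span K (Set.range u) = ⊥ := by
    rw [Submodule.eq_bot_iff]
    rintro x ⟨hxW, hx⟩
    obtain ⟨a, rfl⟩ := (Submodule.mem_span_range_iff_exists_fun K).1 hx
    by_contra hcon
    obtain ⟨k, j, hj, hj'⟩ := h.exists_valuation_sum_smul u r hu hinj (a := a) (by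
      rintro rfl; simp at hcon)
    have hk : (k : ZMod n) ∉ valuationClasses v n W := by
      have hkD := k.2
      generalize (k : ZMod n) = c at hkD ⊢
      rwa [hD, Finset.mem_compl] at hkD
    exact hk (mem_valuationClasses.2 ⟨_, hxW, j, hj, by rw [hj', hr]⟩)
  have h1 := Submodule.finrank_sup_add_finrank_inf_eq W (Submodule.span K (Set.range u))
  rw [hdisj, finrank_bot, finrank_span_eq_card hind, Fintype.card_coe] at h1
  have h4 : D.card = n - (valuationClasses v n W).card := by
    rw [hD, Finset.card_compl, ZMod.card]
  have h2 := Submodule.finrank_le (W ⊔ Submodule.span K (Set.range u))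
  have h3 : (valuationClasses v n W).card ≤ n := by
    simpa using Finset.card_le_univ (valuationClasses v n W)
  lia

/-- A subspace avoiding the valuation class of `1` is orthogonal, for the trace form, to an element
with valuation in the critical class. -/
theorem exists_trace_mul_eq_zero [NeZero n] [FiniteDimensional K L] [Algebra.IsSeparable K L]
    (hn : Module.finrank K L = n)
    (hres : ∀ x : L, v x ≤ 1 → ∃ r : K, v (algebraMap K L r) ≤ 1 ∧ v (x - algebraMap K L r) < 1)
    {W : Submodule K L} (hW : ∀ x ∈ W, v x ≠ 1) {i : ℤ} (hi : i ≡ w + 1 [ZMOD n]) :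
    ∃ ρ : L, v ρ = exp i ∧ ∀ y ∈ W, Algebra.trace K L (ρ * y) = 0 := by
  classical
  set W' := (Algebra.traceForm K L).orthogonal W with hW'
  have hfin : Module.finrank K W' = n - Module.finrank K W := by
    rw [← hn, hW']
    exact LinearMap.BilinForm.finrank_orthogonal (traceForm_nondegenerate K L) W
  have hle : Module.finrank K W ≤ n := hn ▸ Submodule.finrank_le W
  have horth : ∀ ρ ∈ W', ∀ y ∈ W, Algebra.trace K L (ρ * y) = 0 := by
    intro ρ hρ y hy
    rw [mul_comm]
    exact hρ y hy
  suffices hc : ((w + 1 : ℤ) : ZMod n) ∈ valuationClasses v n W' by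
    obtain ⟨ρ, hρ, k, hk, hk'⟩ := mem_valuationClasses.1 hc
    rw [ZMod.intCast_eq_intCast_iff] at hk'
    obtain ⟨j, hj⟩ := (hi.trans hk'.symm).symm.dvd
    obtain ⟨a, ha⟩ := h.exists_scalar j
    refine ⟨a • ρ, ?_, horth _ (W'.smul_mem a hρ)⟩
    rw [Algebra.smul_def, map_mul, ha, hk, ← exp_add, ← hj]; congr 1; ring
  by_contra hc
  -- `c ↦ w + 1 - c` maps the classes of `W` off those of `W'`, and off the critical class
  set f : ZMod n ↪ ZMod n := (Equiv.subLeft ((w + 1 : ℤ) : ZMod n)).toEmbedding with hf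
  have h1 : Disjoint ((valuationClasses v n W).map f) (valuationClasses v n W') := by
    rw [Finset.disjoint_left]
    rintro _ hc1 hc2
    obtain ⟨c, hc, rfl⟩ := Finset.mem_map.1 hc1
    obtain ⟨y, hy, k, hk, rfl⟩ := mem_valuationClasses.1 hc
    obtain ⟨ρ, hρ, l, hl, hl'⟩ := mem_valuationClasses.1 hc2
    refine h.trace_ne_zero hres (i := l + k) (ρ := ρ * y) ?_ (by rw [map_mul, hl, hk, ← exp_add])
      (horth ρ hρ y hy)
    rw [← ZMod.intCast_eq_intCast_iff, Int.cast_add, hl']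
    simp [hf]
  have h2 : ((w + 1 : ℤ) : ZMod n) ∉ (valuationClasses v n W).map f := by
    intro hc1
    obtain ⟨c, hc, hc'⟩ := Finset.mem_map.1 hc1
    have hc0 : c = 0 := by simpa [hf] using hc'
    obtain ⟨y, hy, k, hk, hk'⟩ := mem_valuationClasses.1 hc
    rw [hc0, ZMod.intCast_zmod_eq_zero_iff_dvd] at hk'
    obtain ⟨j, rfl⟩ := hk'
    obtain ⟨a, ha⟩ := h.exists_scalar (-j)
    refine hW _ (W.smul_mem a hy) ?_
    rw [Algebra.smul_def, map_mul, ha, hk, ← exp_add, ← exp_zero]; congr 1; ring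
  have h3 := Finset.card_le_univ
    (insert ((w + 1 : ℤ) : ZMod n) ((valuationClasses v n W).map f ∪ valuationClasses v n W'))
  rw [Finset.card_insert_of_notMem (by simp only [Finset.mem_union, not_or]; exact ⟨h2, hc⟩),
    Finset.card_union_of_disjoint h1, Finset.card_map, ZMod.card] at h3
  have h4 := h.finrank_le_card_valuationClasses hn W
  have h5 := h.finrank_le_card_valuationClasses hn W'
  lia
end

/-- A subspace stable under `x ↦ x ^ p` which does not contain `1` contains no element of valuation
`0`: such an element may be taken to be `1 + u` with `v u < 1`, and the elements
`1 + u ^ (p ^ k)` of the subspace tend to `1`. -/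
theorem valuation_ne_one {e : ℤ} (h : IsTraceValuation K v e w) (p : ℕ) [Fact p.Prime] [CharP L p]
    [FiniteDimensional K L] [Algebra.IsSeparable K L]
    (hres : ∀ x : L, v x ≤ 1 → ∃ r : K, v (algebraMap K L r) ≤ 1 ∧ v (x - algebraMap K L r) < 1)
    {W : Submodule K L} (hW1 : (1 : L) ∉ W) (hWp : ∀ x ∈ W, x ^ p ∈ W) :
    ∀ x ∈ W, v x ≠ 1 := by
  intro x hx hv
  obtain ⟨r, -, hr⟩ := hres x hv.le
  have hr1 : v (algebraMap K L r) = 1 := by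
    rw [← hv]
    exact Valuation.map_eq_of_sub_lt v (by rwa [Valuation.map_sub_swap, hv])
  have hr0 : r ≠ 0 := by rintro rfl; simp at hr1
  obtain ⟨u, hu, huW⟩ : ∃ u : L, v u < 1 ∧ 1 + u ∈ W := by
    refine ⟨r⁻¹ • (x - algebraMap K L r), ?_, ?_⟩
    · rwa [Algebra.smul_def, map_mul, map_inv₀, map_inv₀, hr1, inv_one, one_mul]
    · convert W.smul_mem r⁻¹ hx using 1
      rw [smul_sub, Algebra.smul_def r⁻¹ (algebraMap K L r), ← map_mul, inv_mul_cancel₀ hr0,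
        map_one, add_sub_cancel]
  have hpow : ∀ k : ℕ, 1 + u ^ p ^ k ∈ W := by
    intro k
    induction k with
    | zero => simpa using huW
    | succ k ih =>
      have := hWp _ ih
      rwa [add_pow_char, one_pow, ← pow_mul, ← pow_succ] at this
  obtain ⟨φ, hφ1, hφW⟩ := Submodule.exists_le_ker_of_notMem hW1
  obtain ⟨c, hc⟩ : ∃ c : L, ∀ y, Algebra.trace K L (c * y) = φ y :=
    ⟨((Algebra.traceForm K L).toDual (traceForm_nondegenerate K L)).symm φ, fun y =>
      LinearMap.BilinForm.apply_toDual_symm_apply (hB := traceForm_nondegenerate K L) φ y⟩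
  have hT : ∀ k : ℕ, Algebra.trace K L (c * u ^ p ^ k) = -φ 1 := by
    intro k
    have := LinearMap.mem_ker.1 (hφW (hpow k))
    rw [map_add] at this
    rw [hc, eq_neg_iff_add_eq_zero, add_comm, this]
  have hc0 : c ≠ 0 := by
    rintro rfl
    exact hφ1 (by rw [← hc, zero_mul, map_zero])
  obtain ⟨γ, hγ⟩ := exists_valuation_eq_exp (v := v) hc0
  obtain ⟨j, hj⟩ := h.exists_valuation_algebraMap _ hφ1
  -- for large `k` the trace of `c * u ^ (p ^ k)` is smaller than that of `c`
  set N : ℕ := (γ - w - e * (j - 1)).toNat with hN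
  have hlt : N < p ^ N := Nat.lt_pow_self (Fact.out : p.Prime).one_lt
  have hle := h.trace_le_exp (z := c * u ^ p ^ N) (j - 1) (by
    rw [map_mul, map_pow, hγ]
    calc exp γ * v u ^ p ^ N ≤ exp γ * exp (-1) ^ p ^ N := by
          gcongr; exact valuation_le_exp_neg_one hu
      _ = exp (γ - (p ^ N : ℕ)) := by
          rw [← exp_nsmul, ← exp_add]; congr 1; simp [sub_eq_add_neg]
      _ ≤ _ := by
          rw [exp_le_exp]
          have := Int.self_le_toNat (γ - w - e * (j - 1))
          lia)
  rw [hT, map_neg, Valuation.map_neg, hj, exp_le_exp] at hle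
  nlinarith [h.pos]
end IsTraceValuation
end

/-! ### Finite extensions of discrete valuation rings -/

section
open WithZero

lemma valuation_maximalIdeal_of_irreducible (S L : Type*) [CommRing S] [IsDomain S]
    [IsDiscreteValuationRing S] [Field L] [Algebra S L] [IsFractionRing S L] {ϖ : S}
    (hϖ : Irreducible ϖ) :
    (IsDiscreteValuationRing.maximalIdeal S).valuation L (algebraMap S L ϖ) = exp (-1) := by
  rw [IsDedekindDomain.HeightOneSpectrum.valuation_of_algebraMap]
  exact IsDedekindDomain.HeightOneSpectrum.intValuation_singleton _ hϖ.ne_zero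
    ((IsDiscreteValuationRing.irreducible_iff_uniformizer ϖ).1 hϖ)

lemma valuation_maximalIdeal_le_one_iff (S : Type*) {L : Type*} [CommRing S] [IsDomain S]
    [IsDiscreteValuationRing S] [Field L] [Algebra S L] [IsFractionRing S L] {x : L} :
    (IsDiscreteValuationRing.maximalIdeal S).valuation L x ≤ 1 ↔ ∃ s : S, algebraMap S L s = x := by
  refine ⟨IsDiscreteValuationRing.exists_lift_of_le_one, ?_⟩
  rintro ⟨s, rfl⟩
  exact IsDedekindDomain.HeightOneSpectrum.valuation_le_one _ _

lemma valuation_maximalIdeal_lt_one_iff (S L : Type*) [CommRing S] [IsDomain S]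
    [IsDiscreteValuationRing S] [Field L] [Algebra S L] [IsFractionRing S L] {s : S} :
    (IsDiscreteValuationRing.maximalIdeal S).valuation L (algebraMap S L s) < 1 ↔
      s ∈ IsLocalRing.maximalIdeal S :=
  IsDedekindDomain.HeightOneSpectrum.valuation_lt_one_iff_mem _ _

variable (R S K L : Type*)
  [CommRing R] [IsDomain R] [IsDiscreteValuationRing R]
  [CommRing S] [IsDomain S] [IsDiscreteValuationRing S]
  [Algebra R S] [Module.IsTorsionFree R S] [Module.Finite R S]
  [Field K] [Algebra R K] [IsFractionRing R K]
  [Field L] [Algebra S L] [IsFractionRing S L]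
  [Algebra K L] [Algebra R L] [IsScalarTower R K L] [IsScalarTower R S L]

omit [IsDiscreteValuationRing R] [Module.IsTorsionFree R S] in
include R S in
lemma finiteDimensional_of_isFractionRing [IsIntegrallyClosed R] [Algebra.IsSeparable K L] :
    FiniteDimensional K L := by
  have := IsIntegralClosure.of_isIntegrallyClosed S R L
  have := IsIntegralClosure.isLocalization R K L S
  exact Module.Finite.of_isLocalization R S R⁰

/-- The elements of valuation at least `-differentValuation R S L` are those of the inverse
different. -/
lemma valuation_le_exp_differentValuation_iff [Algebra.IsSeparable K L] (x : L) :
    (IsDiscreteValuationRing.maximalIdeal S).valuation L x ≤ exp (differentValuation R S L) ↔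
      ∀ s : S, Algebra.trace K L (x * algebraMap S L s) ∈ (algebraMap R K).range := by
  have := finiteDimensional_of_isFractionRing R S K L
  have := IsIntegralClosure.of_isIntegrallyClosed S R L
  have hd := coeIdeal_differentIdeal R K L S
  have hdual : x ∈ FractionalIdeal.dual R K (1 : FractionalIdeal S⁰ L) ↔
      ∀ s : S, Algebra.trace K L (x * algebraMap S L s) ∈ (algebraMap R K).range := by
    rw [FractionalIdeal.mem_dual (one_ne_zero (α := FractionalIdeal S⁰ L))]
    refine ⟨fun h s => h _ ((FractionalIdeal.mem_one_iff _).2 ⟨s, rfl⟩), fun h a ha => ?_⟩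
    obtain ⟨s, rfl⟩ := (FractionalIdeal.mem_one_iff _).1 ha
    exact h s
  rw [← hdual]
  have hD : differentIdeal R S ≠ ⊥ := by
    rintro h0
    rw [h0, FractionalIdeal.coeIdeal_bot, eq_comm, inv_eq_zero,
      FractionalIdeal.dual_eq_zero_iff] at hd
    exact one_ne_zero hd
  obtain ⟨ϖ, hϖ⟩ := IsDiscreteValuationRing.exists_irreducible S
  obtain ⟨m, hm⟩ := IsDiscreteValuationRing.ideal_eq_span_pow_irreducible hD hϖ
  have hϖ0 : algebraMap S L ϖ ≠ 0 := by
    simpa using hϖ.ne_zero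
  have hw : differentValuation R S L = m := by
    have h1 : (differentIdeal R S : FractionalIdeal S⁰ L) =
        ((IsDiscreteValuationRing.maximalIdeal S).asIdeal : FractionalIdeal S⁰ L) ^ m := by
      rw [hm, ← FractionalIdeal.coeIdeal_pow, ← Ideal.span_singleton_pow]
      congr 2
      exact ((IsDiscreteValuationRing.irreducible_iff_uniformizer ϖ).1 hϖ).symm
    rw [differentValuation, h1, FractionalIdeal.count_pow_self]
  have hinv : FractionalIdeal.dual R K (1 : FractionalIdeal S⁰ L) =
      FractionalIdeal.spanSingleton S⁰ (algebraMap S L ϖ ^ m)⁻¹ := by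
    rw [← inv_inv (FractionalIdeal.dual R K (1 : FractionalIdeal S⁰ L)), ← hd, hm,
      FractionalIdeal.coeIdeal_span_singleton, FractionalIdeal.spanSingleton_inv, map_pow]
  rw [hinv, FractionalIdeal.mem_spanSingleton, hw]
  have h2 : (IsDiscreteValuationRing.maximalIdeal S).valuation L x ≤ exp (m : ℤ) ↔
      (IsDiscreteValuationRing.maximalIdeal S).valuation L (algebraMap S L ϖ ^ m * x) ≤ 1 := by
    rw [map_mul, map_pow, valuation_maximalIdeal_of_irreducible S L hϖ, ← exp_nsmul, smul_neg,
      nsmul_one, exp_neg, inv_mul_le_one₀ exp_pos]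
  rw [h2, valuation_maximalIdeal_le_one_iff]
  refine exists_congr fun s => ?_
  rw [Algebra.smul_def, ← div_eq_mul_inv, div_eq_iff (pow_ne_zero _ hϖ0), mul_comm x]

omit [Module.IsTorsionFree R S] in
lemma valuation_algebraMap_le_one_iff {x : K} :
    (IsDiscreteValuationRing.maximalIdeal S).valuation L (algebraMap K L x) ≤ 1 ↔
      x ∈ (algebraMap R K).range := by
  rw [valuation_maximalIdeal_le_one_iff]
  constructor
  · rintro ⟨s, hs⟩
    have h1 : IsIntegral R (algebraMap K L x) := hs ▸ (Algebra.IsIntegral.isIntegral s).algebraMap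
    have h2 : IsIntegral R x := (isIntegral_algebraMap_iff (algebraMap K L).injective).1 h1
    exact IsIntegrallyClosed.isIntegral_iff.1 h2
  · rintro ⟨r, rfl⟩
    exact ⟨algebraMap R S r, by
      rw [← IsScalarTower.algebraMap_apply, ← IsScalarTower.algebraMap_apply]⟩

theorem isTraceValuation_maximalIdeal [Algebra.IsSeparable K L] :
    IsTraceValuation K ((IsDiscreteValuationRing.maximalIdeal S).valuation L)
      (Ideal.ramificationIdx' (IsLocalRing.maximalIdeal R) (IsLocalRing.maximalIdeal S))
      (differentValuation R S L) := by
  set v := (IsDiscreteValuationRing.maximalIdeal S).valuation L with hv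
  obtain ⟨π, hπ⟩ := IsDiscreteValuationRing.exists_irreducible R
  obtain ⟨ϖ, hϖ⟩ := IsDiscreteValuationRing.exists_irreducible S
  have hϖ1 : v (algebraMap S L ϖ) = exp (-1) := valuation_maximalIdeal_of_irreducible S L hϖ
  have hinj : Function.Injective (algebraMap R S) := FaithfulSMul.algebraMap_injective R S
  have hπ0 : algebraMap R S π ≠ 0 := by simpa using hπ.ne_zero
  obtain ⟨m, u, hu⟩ := IsDiscreteValuationRing.eq_unit_mul_pow_irreducible hπ0 hϖ
  have hunit : ∀ u : Sˣ, v (algebraMap S L u) = 1 := by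
    intro u
    rw [hv, IsDedekindDomain.HeightOneSpectrum.valuation_eq_one_iff_notMem]
    exact fun h => (IsLocalRing.mem_maximalIdeal _).1 h u.isUnit
  have hpm : ∀ k : ℕ, IsLocalRing.maximalIdeal S ^ k = Ideal.span {ϖ ^ k} := fun k => by
    rw [(IsDiscreteValuationRing.irreducible_iff_uniformizer ϖ).1 hϖ, Ideal.span_singleton_pow]
  have hmap : Ideal.map (algebraMap R S) (IsLocalRing.maximalIdeal R) =
      IsLocalRing.maximalIdeal S ^ m := by
    rw [hpm, (IsDiscreteValuationRing.irreducible_iff_uniformizer π).1 hπ, Ideal.map_span,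
      Set.image_singleton, hu]
    exact Ideal.span_singleton_mul_left_unit u.isUnit _
  have he : Ideal.ramificationIdx' (IsLocalRing.maximalIdeal R) (IsLocalRing.maximalIdeal S) = m := by
    refine Ideal.ramificationIdx'_spec hmap.le ?_
    rw [hmap, hpm, hpm, Ideal.span_singleton_le_span_singleton, pow_dvd_pow_iff hϖ.ne_zero hϖ.not_isUnit]
    simp
  have hvπ : v (algebraMap K L (algebraMap R K π)) = exp (-(m : ℤ)) := by
    rw [← IsScalarTower.algebraMap_apply, IsScalarTower.algebraMap_apply R S L, hu, map_mul, map_mul,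
      hunit, map_pow, map_pow, hϖ1, ← exp_nsmul]
    simp
  rw [he]
  refine ⟨fun i => IsDedekindDomain.HeightOneSpectrum.valuation_surjective L _ _, ?_, ⟨_, hvπ⟩, ?_, ?_⟩
  · rw [Int.natCast_pos, Nat.pos_iff_ne_zero]
    rintro rfl
    have h1 : v (algebraMap K L (algebraMap R K π)⁻¹) ≤ 1 := by
      rw [map_inv₀, map_inv₀, hvπ]; simp
    obtain ⟨r, hr⟩ := (valuation_algebraMap_le_one_iff R S K L).1 h1
    refine hπ.not_isUnit (IsUnit.of_mul_eq_one r (IsFractionRing.injective R K ?_))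
    rw [map_mul, hr, map_one, mul_inv_cancel₀]
    simpa using hπ.ne_zero
  · intro x hx
    have hR : ∀ r : R, r ≠ 0 → ∃ j : ℤ, v (algebraMap K L (algebraMap R K r)) = exp (m * j) := by
      intro r hr
      obtain ⟨k, u, rfl⟩ := IsDiscreteValuationRing.eq_unit_mul_pow_irreducible hr hπ
      refine ⟨-k, ?_⟩
      have hu1 : v (algebraMap K L (algebraMap R K u)) = 1 := by
        rw [← IsScalarTower.algebraMap_apply, IsScalarTower.algebraMap_apply R S L]
        exact hunit (Units.map (algebraMap R S) u)
      rw [map_mul, map_mul, map_mul, hu1, map_pow, map_pow, map_pow, hvπ, ← exp_nsmul, one_mul]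
      congr 1
      simp only [smul_neg, nsmul_eq_mul]; ring
    obtain ⟨a, b, hb, rfl⟩ := IsFractionRing.div_surjective R x
    obtain ⟨j, hj⟩ := hR a (by rintro rfl; simp at hx)
    obtain ⟨k, hk⟩ := hR b (nonZeroDivisors.ne_zero hb)
    exact ⟨j - k, by rw [map_div₀, map_div₀, hj, hk, ← exp_sub, mul_sub]⟩
  · intro x
    rw [valuation_le_exp_differentValuation_iff R S K L]
    simp_rw [hv, valuation_algebraMap_le_one_iff R S K L, valuation_maximalIdeal_le_one_iff]
    simp

lemma isTotallyRamified_iff_surjective [Algebra.IsSeparable K L] :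
    IsTotallyRamified R S K L ↔
      ∀ s : S, ∃ r : R, s - algebraMap R S r ∈ IsLocalRing.maximalIdeal S := by
  have := finiteDimensional_of_isFractionRing R S K L
  have hR0 : IsLocalRing.maximalIdeal R ≠ ⊥ := IsDiscreteValuationRing.not_a_field R
  have hn : 0 < Module.finrank K L := Module.finrank_pos
  have hlies : (IsLocalRing.maximalIdeal S).LiesOver (IsLocalRing.maximalIdeal R) := inferInstance
  have hfund : Ideal.ramificationIdx' (IsLocalRing.maximalIdeal R) (IsLocalRing.maximalIdeal S) *
      Module.finrank (R ⧸ IsLocalRing.maximalIdeal R) (S ⧸ IsLocalRing.maximalIdeal S) =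
        Module.finrank K L := by
    rw [← Ideal.sum_ramification_inertia S K L hR0, IsLocalRing.primesOverFinset_eq S hR0,
      Finset.sum_singleton, Ideal.inertiaDeg'_algebraMap]
  have h1 : IsTotallyRamified R S K L ↔
      Module.finrank (R ⧸ IsLocalRing.maximalIdeal R) (S ⧸ IsLocalRing.maximalIdeal S) = 1 := by
    rw [IsTotallyRamified, ← hfund, eq_comm, Nat.mul_eq_left]
    rintro h0
    simp [h0] at hfund
    lia
  let _ := Ideal.Quotient.field (IsLocalRing.maximalIdeal R)
  rw [h1, ← Subalgebra.bot_eq_top_iff_finrank_eq_one, Algebra.eq_top_iff]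
  constructor
  · intro h s
    obtain ⟨r, hr⟩ := Algebra.mem_bot.1 (h (Ideal.Quotient.mk _ s))
    obtain ⟨r, rfl⟩ := Ideal.Quotient.mk_surjective r
    exact ⟨r, Ideal.Quotient.eq.1 hr.symm⟩
  · intro h s
    obtain ⟨s, rfl⟩ := Ideal.Quotient.mk_surjective s
    obtain ⟨r, hr⟩ := h s
    exact Algebra.mem_bot.2 ⟨Ideal.Quotient.mk _ r, (Ideal.Quotient.eq.2 hr).symm⟩

variable {R S K L} in
lemma IsTotallyRamified.exists_valuation_sub_lt [Algebra.IsSeparable K L]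
    (h : IsTotallyRamified R S K L) (x : L)
    (hx : (IsDiscreteValuationRing.maximalIdeal S).valuation L x ≤ 1) :
    ∃ r : K, (IsDiscreteValuationRing.maximalIdeal S).valuation L (algebraMap K L r) ≤ 1 ∧
      (IsDiscreteValuationRing.maximalIdeal S).valuation L (x - algebraMap K L r) < 1 := by
  obtain ⟨s, rfl⟩ := (valuation_maximalIdeal_le_one_iff S).1 hx
  obtain ⟨r, hr⟩ := (isTotallyRamified_iff_surjective R S K L).1 h s
  refine ⟨algebraMap R K r, (valuation_algebraMap_le_one_iff R S K L).2 ⟨r, rfl⟩, ?_⟩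
  rwa [← IsScalarTower.algebraMap_apply, IsScalarTower.algebraMap_apply R S L, ← map_sub,
    valuation_maximalIdeal_lt_one_iff]

variable {R S K L} in
lemma exists_valuation_sub_eq_one_of_not_isTotallyRamified [Algebra.IsSeparable K L]
    (h : ¬ IsTotallyRamified R S K L) :
    ∃ x : L, (IsDiscreteValuationRing.maximalIdeal S).valuation L x ≤ 1 ∧
      ∀ r : K, (IsDiscreteValuationRing.maximalIdeal S).valuation L (algebraMap K L r) ≤ 1 →
        (IsDiscreteValuationRing.maximalIdeal S).valuation L (x - algebraMap K L r) = 1 := by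
  rw [isTotallyRamified_iff_surjective] at h
  push Not at h
  obtain ⟨s, hs⟩ := h
  refine ⟨algebraMap S L s, (valuation_maximalIdeal_le_one_iff S).2 ⟨s, rfl⟩, fun r hr => ?_⟩
  obtain ⟨r, rfl⟩ := (valuation_algebraMap_le_one_iff R S K L).1 hr
  have := hs r
  rw [← valuation_maximalIdeal_lt_one_iff S L, map_sub, ← IsScalarTower.algebraMap_apply,
    IsScalarTower.algebraMap_apply R K L, not_lt] at this
  refine this.antisymm' ?_
  rw [← IsScalarTower.algebraMap_apply, IsScalarTower.algebraMap_apply R S L, ← map_sub]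
  exact IsDedekindDomain.HeightOneSpectrum.valuation_le_one _ _

end

/-! ### Embeddings and grouplike elements after extension of scalars -/

noncomputable section

variable (K L H Ω : Type*) [Field K] [Field L] [Algebra K L]
    [Ring H] [HopfAlgebra K H] [Module H L] [IsScalarTower K H L] [Field Ω] [Algebra K Ω]

/-- The action of `Ω ⊗ H` on `Ω ⊗ L` obtained by base change from that of `H` on `L`. -/
def hopfAction : (Ω ⊗[K] H) →ₐ[Ω] Module.End Ω (Ω ⊗[K] L) :=
  Algebra.TensorProduct.lift (Algebra.ofId Ω _)
    ((Module.End.baseChangeHom K Ω L).comp (Algebra.lsmul K K L : H →ₐ[K] Module.End K L))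
    fun ω _ => by rw [Algebra.ofId_apply]; exact Algebra.commute_algebraMap_left ω _

variable {K L H Ω}

@[simp]
lemma hopfAction_tmul (ω ω' : Ω) (h : H) (x : L) :
    hopfAction K L H Ω (ω ⊗ₜ h) (ω' ⊗ₜ x) = (ω * ω') ⊗ₜ (h • x) := by
  rw [hopfAction, Algebra.TensorProduct.lift_tmul, Module.End.mul_apply]
  change ω • (ω' ⊗ₜ[K] (h • x)) = _
  rw [TensorProduct.smul_tmul', smul_eq_mul]

/-- The `Ω`-algebra homomorphism `Ω ⊗ L → Ω` extending an embedding of `L`. -/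
def extendScalars (ι : L →ₐ[K] Ω) : Ω ⊗[K] L →ₐ[Ω] Ω :=
  Algebra.TensorProduct.lift (AlgHom.id Ω Ω) ι fun _ _ => Commute.all _ _

@[simp]
lemma extendScalars_tmul (ι : L →ₐ[K] Ω) (ω : Ω) (x : L) :
    extendScalars ι (ω ⊗ₜ x) = ω * ι x := by
  simp [extendScalars]

lemma hopfAction_one (hH : IsHopfModuleAlgebra K L H) (a : Ω ⊗[K] H) :
    hopfAction K L H Ω a 1 = Coalgebra.counit (R := Ω) a • 1 := by
  induction a with
  | zero => simp
  | add a b ha hb => rw [map_add, LinearMap.add_apply, ha, hb, map_add, add_smul]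
  | tmul ω h =>
    rw [Algebra.TensorProduct.one_def, hopfAction_tmul, hH.smul_one, TensorProduct.smul_tmul',
      TensorProduct.counit_tmul, Algebra.algebraMap_eq_smul_one, TensorProduct.tmul_smul,
      TensorProduct.smul_tmul']
    simp

lemma hopfAction_mul (hH : IsHopfModuleAlgebra K L H) (a : Ω ⊗[K] H) (x y : Ω ⊗[K] L) :
    hopfAction K L H Ω a (x * y) = LinearMap.mul' Ω (Ω ⊗[K] L)
      (TensorProduct.map ((hopfAction K L H Ω).toLinearMap.flip x)
        ((hopfAction K L H Ω).toLinearMap.flip y) (Coalgebra.comul (R := Ω) a)) := by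
  induction a with
  | zero => simp
  | add a b ha hb => rw [map_add, LinearMap.add_apply, ha, hb, map_add, map_add, map_add]
  | tmul ω h =>
  induction x with
  | zero => simp
  | add x x' hx hx' =>
    rw [add_mul, map_add, hx, hx', map_add, TensorProduct.map_add_left, LinearMap.add_apply, map_add]
  | tmul ω' x =>
  induction y with
  | zero => simp
  | add y y' hy hy' =>
    rw [mul_add, map_add, hy, hy', map_add, TensorProduct.map_add_right, LinearMap.add_apply, map_add]
  | tmul ω'' y =>
    rw [Algebra.TensorProduct.tmul_mul_tmul, hopfAction_tmul, hH.smul_mul,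
      TensorProduct.comul_tmul, CommSemiring.comul_apply]
    induction Coalgebra.comul (R := K) h with
    | zero => simp
    | add s t hs ht =>
      rw [map_add, map_add, TensorProduct.tmul_add, hs, ht, TensorProduct.tmul_add, map_add, map_add,
        map_add]
    | tmul h₁ h₂ =>
      simp [hopfEval]
      ring_nf

/-- Evaluating the action of `a` at an embedding. -/
def hopfFunctional (H : Type*) [Ring H] [HopfAlgebra K H] [Module H L] [IsScalarTower K H L]
    (ι : L →ₐ[K] Ω) : (Ω ⊗[K] H) →ₗ[Ω] Module.Dual Ω (Ω ⊗[K] L) :=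
  (LinearMap.compRight Ω (extendScalars ι).toLinearMap).comp (hopfAction K L H Ω).toLinearMap

@[simp]
lemma hopfFunctional_apply (ι : L →ₐ[K] Ω) (a : Ω ⊗[K] H) (x : Ω ⊗[K] L) :
    hopfFunctional H ι a x = extendScalars ι (hopfAction K L H Ω a x) := rfl
variable [FiniteDimensional K L]

lemma IsHopfGalois.finiteDimensional (hH : IsHopfGalois K L H) : FiniteDimensional K H := by
  refine Module.Finite.of_injective ((hopfGaloisMap K L H).comp (TensorProduct.mk K L H 1)) ?_
  rw [LinearMap.coe_comp]
  exact hH.bijective.1.comp (Algebra.TensorProduct.includeRight_injective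
    (algebraMap K L).injective)

lemma IsHopfGalois.finrank_eq (hH : IsHopfGalois K L H) :
    Module.finrank K H = Module.finrank K L := by
  have := hH.finiteDimensional
  have h1 := (LinearEquiv.ofBijective _ hH.bijective).finrank_eq
  rw [Module.finrank_tensorProduct, Module.finrank_linearMap] at h1
  exact mul_left_cancel₀ Module.finrank_pos.ne' h1

lemma hopfFunctional_bijective (hH : IsHopfGalois K L H) (ι : L →ₐ[K] Ω) :
    Function.Bijective (hopfFunctional H ι) := by
  have := hH.finiteDimensional
  have hfin : Module.finrank Ω (Ω ⊗[K] H) = Module.finrank Ω (Module.Dual Ω (Ω ⊗[K] L)) := by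
    rw [Subspace.dual_finrank_eq, Module.finrank_baseChange, Module.finrank_baseChange,
      hH.finrank_eq]
  suffices hs : Function.Surjective (hopfFunctional H ι) from
    ⟨(LinearMap.injective_iff_surjective_of_finrank_eq_finrank hfin).2 hs, hs⟩
  have key : ∀ f : Module.End K L, ∃ a, ∀ x : L, hopfFunctional H ι a (1 ⊗ₜ x) = ι (f x) := by
    intro f
    obtain ⟨t, rfl⟩ := hH.bijective.2 f
    refine ⟨TensorProduct.map ι.toLinearMap LinearMap.id t, fun x => ?_⟩
    induction t with
    | zero => simp
    | add s t hs ht => simp_all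
    | tmul l h => simp [hopfGaloisMap]
  intro φ
  set B := Module.finBasis K L
  choose a ha using fun i => key ((B.coord i).smulRight 1)
  refine ⟨∑ i, φ (1 ⊗ₜ B i) • a i, ?_⟩
  apply (B.baseChange Ω).ext
  intro j
  rw [map_sum, LinearMap.sum_apply, Finset.sum_eq_single j]
  · simp only [map_smul, LinearMap.smul_apply, Module.Basis.baseChange_apply]
    rw [ha]; simp
  · intro i _ hij
    simp only [map_smul, LinearMap.smul_apply, Module.Basis.baseChange_apply]
    rw [ha]; simp [hij]
  · simp

omit [FiniteDimensional K L] in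
lemma linearIndependent_extendScalars :
    LinearIndependent Ω fun σ : L →ₐ[K] Ω => (extendScalars σ).toLinearMap := by
  have h := linearIndependent_toLinearMap K L Ω
  rw [linearIndependent_iff'] at h ⊢
  intro s c hc
  refine h s c (LinearMap.ext fun x => ?_)
  simpa using LinearMap.congr_fun hc (1 ⊗ₜ x)

/-- Dedekind's independence of characters, for products of two embeddings. -/
lemma eq_zero_of_forall_sum_mul_eq_zero (c : (L →ₐ[K] Ω) × (L →ₐ[K] Ω) → Ω)
    (hc : ∀ x y : L, ∑ στ : (L →ₐ[K] Ω) × (L →ₐ[K] Ω), c στ * (στ.1 x * στ.2 y) = 0) : c = 0 := by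
  let χ : (L →ₐ[K] Ω) × (L →ₐ[K] Ω) → (L × L →* Ω) := fun στ =>
    ((στ.1 : L →* Ω).comp (MonoidHom.fst L L)) * ((στ.2 : L →* Ω).comp (MonoidHom.snd L L))
  have hχ : Function.Injective χ := by
    rintro ⟨σ, τ⟩ ⟨σ', τ'⟩ h
    refine Prod.ext (AlgHom.ext fun x => ?_) (AlgHom.ext fun y => ?_)
    · simpa [χ] using DFunLike.congr_fun h (x, 1)
    · simpa [χ] using DFunLike.congr_fun h (1, y)
  have h := (linearIndependent_monoidHom (L × L) Ω).comp χ hχ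
  rw [Fintype.linearIndependent_iff] at h
  funext στ
  refine h c (funext fun xy => ?_) στ
  simpa [χ] using hc xy.1 xy.2

variable [IsAlgClosed Ω] [Algebra.IsSeparable K L]

variable (K L Ω) in
lemma card_algHom_eq_finrank : Fintype.card (L →ₐ[K] Ω) = Module.finrank K L :=
  AlgHom.card K L Ω

/-- The basis of `Ω ⊗ H` corresponding to the embeddings of `L`. -/
def hopfBasis (hH : IsHopfGalois K L H) (ι : L →ₐ[K] Ω) :
    Module.Basis (L →ₐ[K] Ω) Ω (Ω ⊗[K] H) :=
  have : Nonempty (L →ₐ[K] Ω) := ⟨ι⟩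
  (basisOfLinearIndependentOfCardEqFinrank (linearIndependent_extendScalars (K := K) (L := L)) (by
    rw [card_algHom_eq_finrank, Subspace.dual_finrank_eq, Module.finrank_baseChange])).map
    (LinearEquiv.ofBijective _ (hopfFunctional_bijective hH ι)).symm

lemma hopfFunctional_hopfBasis (hH : IsHopfGalois K L H) (ι σ : L →ₐ[K] Ω) :
    hopfFunctional H ι (hopfBasis hH ι σ) = (extendScalars σ).toLinearMap := by
  have : Nonempty (L →ₐ[K] Ω) := ⟨ι⟩
  rw [hopfBasis, Module.Basis.map_apply, coe_basisOfLinearIndependentOfCardEqFinrank]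
  exact LinearEquiv.apply_ofBijective_symm_apply _ _

lemma extendScalars_hopfBasis (hH : IsHopfGalois K L H) (ι σ : L →ₐ[K] Ω) (x : Ω ⊗[K] L) :
    extendScalars ι (hopfAction K L H Ω (hopfBasis hH ι σ) x) = extendScalars σ x :=
  LinearMap.congr_fun (hopfFunctional_hopfBasis hH ι σ) x

/-- The elements of `Ω ⊗ H` which represent the embeddings are grouplike, since embeddings are
multiplicative. -/
lemma isGroupLikeElem_hopfBasis (hH : IsHopfGalois K L H) (ι σ : L →ₐ[K] Ω) :
    IsGroupLikeElem Ω (hopfBasis hH ι σ) where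
  counit_eq_one := by
    have h := extendScalars_hopfBasis hH ι σ 1
    rw [hopfAction_one hH.moduleAlgebra] at h
    simpa using h
  comul_eq_tmul_self := by
    set B := hopfBasis hH ι with hB
    have hpair : ∀ x y t, extendScalars ι (LinearMap.mul' Ω (Ω ⊗[K] L)
        (TensorProduct.map ((hopfAction K L H Ω).toLinearMap.flip (1 ⊗ₜ x))
        ((hopfAction K L H Ω).toLinearMap.flip (1 ⊗ₜ y)) t)) =
        ∑ στ : (L →ₐ[K] Ω) × (L →ₐ[K] Ω), (B.tensorProduct B).repr t στ * (στ.1 x * στ.2 y) := by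
      intro x y t
      conv_lhs => rw [← (B.tensorProduct B).sum_repr t]
      simp only [map_sum, map_smul, Module.Basis.tensorProduct_apply', TensorProduct.map_tmul,
        LinearMap.mul'_apply, map_mul, LinearMap.flip_apply, AlgHom.toLinearMap_apply, smul_eq_mul]
      refine Finset.sum_congr rfl fun στ _ => ?_
      rw [hB, extendScalars_hopfBasis, extendScalars_hopfBasis]
      simp
    have hzero := eq_zero_of_forall_sum_mul_eq_zero
      (⇑((B.tensorProduct B).repr (Coalgebra.comul (R := Ω) (B σ) - B σ ⊗ₜ B σ))) (by
        intro x y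
        rw [← hpair, map_sub, map_sub, map_sub, ← hopfAction_mul hH.moduleAlgebra]
        simp only [TensorProduct.map_tmul, LinearMap.mul'_apply, map_mul, LinearMap.flip_apply,
          AlgHom.toLinearMap_apply]
        rw [hB, extendScalars_hopfBasis, extendScalars_hopfBasis, extendScalars_hopfBasis, map_mul,
          sub_self])
    rw [← sub_eq_zero, ← (B.tensorProduct B).repr.map_eq_zero_iff]
    exact DFunLike.coe_injective hzero

/-- Acting by a grouplike element is an algebra homomorphism. -/
def GroupLike.toAlgHom (hH : IsHopfModuleAlgebra K L H) (g : GroupLike Ω (Ω ⊗[K] H)) :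
    Ω ⊗[K] L →ₐ[Ω] Ω ⊗[K] L :=
  AlgHom.ofLinearMap (hopfAction K L H Ω g.val)
    (by rw [hopfAction_one hH, g.2.counit_eq_one, one_smul])
    fun x y => by rw [hopfAction_mul hH, g.2.comul_eq_tmul_self]; simp

/-- Grouplike elements correspond to embeddings: `g` is sent to the embedding `x ↦ ι (g x)`. -/
def groupLikeEquiv (hH : IsHopfGalois K L H) (ι : L →ₐ[K] Ω) :
    GroupLike Ω (Ω ⊗[K] H) ≃ (L →ₐ[K] Ω) where
  toFun g := (((extendScalars ι).comp (g.toAlgHom hH.moduleAlgebra)).restrictScalars K).comp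
    Algebra.TensorProduct.includeRight
  invFun σ := ⟨hopfBasis hH ι σ, isGroupLikeElem_hopfBasis hH ι σ⟩
  left_inv g := by
    refine GroupLike.val_injective ((hopfFunctional_bijective hH ι).1 ?_)
    rw [hopfFunctional_hopfBasis]
    refine TensorProduct.AlgebraTensorModule.curry_injective (LinearMap.ext_ring (LinearMap.ext fun x => ?_))
    simp [GroupLike.toAlgHom]
  right_inv σ := by
    refine AlgHom.ext fun x => ?_
    have := extendScalars_hopfBasis hH ι σ (1 ⊗ₜ x)
    simpa [GroupLike.toAlgHom] using this

end

/-! ### The trace criterion for normal basis generators -/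

noncomputable section

/-- A finite `p`-group acting on an elementary abelian `p`-group fixes a nonzero element of every
nonzero stable subgroup. -/
lemma IsPGroup.exists_ne_zero_forall_smul_eq {p : ℕ} [Fact p.Prime] {G M : Type*} [Group G] [Finite G]
    (hG : IsPGroup p G) [AddCommGroup M] [Module (ZMod p) M] [DistribMulAction G M]
    (S : AddSubgroup M) (hS : ∀ (g : G), ∀ y ∈ S, g • y ∈ S) {x : M} (hxS : x ∈ S) (hx : x ≠ 0) :
    ∃ y ∈ S, y ≠ 0 ∧ ∀ g : G, g • y = y := by
  -- the span of the orbit of `x` is a finite `p`-group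
  set X : Submodule (ZMod p) M := Submodule.span (ZMod p) (Set.range fun g : G => g • x) with hX
  have hxX : x ∈ X := Submodule.subset_span ⟨1, one_smul _ _⟩
  have hXS : X ≤ AddSubgroup.toZModSubmodule p S := by
    rw [hX, Submodule.span_le]
    rintro _ ⟨g, rfl⟩
    exact hS g x hxS
  have hGX : ∀ (g : G), ∀ y ∈ X, g • y ∈ X := by
    intro g
    have : X.map ((DistribSMul.toAddMonoidHom M g).toZModLinearMap p) ≤ X := by
      rw [hX, Submodule.map_span_le]
      rintro _ ⟨h, rfl⟩
      exact Submodule.subset_span ⟨g * h, mul_smul _ _ _⟩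
    exact fun y hy => this ⟨y, hy, rfl⟩
  let _ : MulAction G X :=
    { smul := fun g y => ⟨g • y.1, hGX g y y.2⟩
      one_smul := fun y => Subtype.ext (one_smul _ _)
      mul_smul := fun g h y => Subtype.ext (mul_smul _ _ _) }
  have : Module.Finite (ZMod p) X := Module.Finite.span_of_finite _ (Set.finite_range _)
  have : Finite X := Module.finite_of_finite (ZMod p)
  have hcard : p ∣ Nat.card X := by
    have : Nontrivial X := ⟨⟨x, hxX⟩, 0, fun h => hx (congrArg Subtype.val h)⟩
    rw [Module.natCard_eq_pow_finrank (K := ZMod p), Nat.card_zmod]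
    exact dvd_pow_self p Module.finrank_pos.ne'
  obtain ⟨y, hy, hy0⟩ := hG.exists_fixed_point_of_prime_dvd_card_of_fixed_point X hcard
    (a := 0) (fun g => Subtype.ext (smul_zero g))
  exact ⟨y, hXS y.2, fun h => hy0 (Subtype.ext h.symm), fun g => congrArg Subtype.val (hy g)⟩

variable {K L H Ω : Type*} [Field K] [Field L] [Algebra K L]
    [Ring H] [HopfAlgebra K H] [Module H L] [IsScalarTower K H L] [Field Ω] [Algebra K Ω]

variable [FiniteDimensional K L]

lemma isNormalBasisGenerator_iff_injective (hH : IsHopfGalois K L H) {ρ : L} :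
    IsNormalBasisGenerator H ρ ↔
      ∀ a : Ω ⊗[K] H, hopfAction K L H Ω a (1 ⊗ₜ ρ) = 0 → a = 0 := by
  have := hH.finiteDimensional
  have h1 : IsNormalBasisGenerator H ρ ↔ Function.Injective (hopfEval K H ρ) :=
    ⟨fun h => h.1, fun h =>
      ⟨h, (LinearMap.injective_iff_surjective_of_finrank_eq_finrank hH.finrank_eq).1 h⟩⟩
  have h2 : ∀ a : Ω ⊗[K] H, hopfAction K L H Ω a (1 ⊗ₜ ρ) = (hopfEval K H ρ).lTensor Ω a := by
    intro a
    induction a with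
    | zero => simp
    | add a b ha hb => rw [map_add, LinearMap.add_apply, ha, hb, map_add]
    | tmul ω h => simp [hopfEval]
  rw [h1, ← Module.FaithfullyFlat.lTensor_injective_iff_injective K Ω, injective_iff_map_eq_zero]
  simp_rw [h2]

variable [IsAlgClosed Ω] [Algebra.IsSeparable K L]

/-- The functionals given by the embeddings separate the points of `Ω ⊗ L`. -/
lemma eq_of_forall_extendScalars_eq {x y : Ω ⊗[K] L}
    (h : ∀ σ : L →ₐ[K] Ω, extendScalars σ x = extendScalars σ y) : x = y := by
  have hι : Nonempty (L →ₐ[K] Ω) := ⟨IsAlgClosed.lift⟩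
  let B := basisOfLinearIndependentOfCardEqFinrank
    (linearIndependent_extendScalars (K := K) (L := L) (Ω := Ω))
    (by rw [card_algHom_eq_finrank, Subspace.dual_finrank_eq, Module.finrank_baseChange])
  rw [← sub_eq_zero, ← Module.forall_dual_apply_eq_zero_iff Ω]
  intro φ
  rw [← B.sum_repr φ, LinearMap.sum_apply]
  refine Finset.sum_eq_zero fun σ _ => ?_
  rw [LinearMap.smul_apply, coe_basisOfLinearIndependentOfCardEqFinrank]
  simp [h σ]

/-- `Ω ⊗ L` has elements with prescribed images under the embeddings. -/
lemma exists_forall_extendScalars_eq (f : (L →ₐ[K] Ω) → Ω) :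
    ∃ x : Ω ⊗[K] L, ∀ σ, extendScalars σ x = f σ := by
  let ψ : Ω ⊗[K] L →ₗ[Ω] ((L →ₐ[K] Ω) → Ω) :=
    LinearMap.pi fun σ : L →ₐ[K] Ω => (extendScalars σ).toLinearMap
  have hinj : Function.Injective ψ := fun x y h =>
    eq_of_forall_extendScalars_eq fun σ => congrFun h σ
  obtain ⟨x, hx⟩ := (LinearMap.injective_iff_surjective_of_finrank_eq_finrank (by
    rw [Module.finrank_baseChange, Module.finrank_fintype_fun_eq_card, card_algHom_eq_finrank])).1
    hinj f
  exact ⟨x, fun σ => congrFun hx σ⟩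

lemma extendScalars_hopfAction_groupLike (hH : IsHopfGalois K L H) (ι : L →ₐ[K] Ω)
    (g : GroupLike Ω (Ω ⊗[K] H)) (x : Ω ⊗[K] L) :
    extendScalars ι (hopfAction K L H Ω g.val x) = extendScalars (groupLikeEquiv hH ι g) x := by
  have h : g.val = hopfBasis hH ι (groupLikeEquiv hH ι g) :=
    congrArg GroupLike.val ((groupLikeEquiv hH ι).symm_apply_apply g).symm
  conv_lhs => rw [h]
  exact extendScalars_hopfBasis hH ι _ x

/-- The grouplike elements form a basis of `Ω ⊗ H`. -/
def groupLikeBasis (hH : IsHopfGalois K L H) (ι : L →ₐ[K] Ω) :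
    Module.Basis (GroupLike Ω (Ω ⊗[K] H)) Ω (Ω ⊗[K] H) :=
  (hopfBasis hH ι).reindex (groupLikeEquiv hH ι).symm

@[simp]
lemma groupLikeBasis_apply (hH : IsHopfGalois K L H) (ι : L →ₐ[K] Ω)
    (g : GroupLike Ω (Ω ⊗[K] H)) : groupLikeBasis hH ι g = g.val := by
  rw [groupLikeBasis, Module.Basis.reindex_apply, Equiv.symm_symm]
  exact congrArg GroupLike.val ((groupLikeEquiv hH ι).symm_apply_apply g)

lemma IsHopfGalois.finite_groupLike (hH : IsHopfGalois K L H) :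
    Finite (GroupLike Ω (Ω ⊗[K] H)) :=
  Finite.of_equiv _ (groupLikeEquiv hH IsAlgClosed.lift).symm

lemma IsHopfGalois.card_groupLike (hH : IsHopfGalois K L H) :
    Nat.card (GroupLike Ω (Ω ⊗[K] H)) = Module.finrank K L := by
  rw [Nat.card_congr (groupLikeEquiv hH IsAlgClosed.lift), Nat.card_eq_fintype_card,
    card_algHom_eq_finrank]

lemma eq_of_forall_extendScalars_groupLike (hH : IsHopfGalois K L H) (ι : L →ₐ[K] Ω)
    {x y : Ω ⊗[K] L} (h : ∀ g : GroupLike Ω (Ω ⊗[K] H),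
      extendScalars ι (hopfAction K L H Ω g.val x) = extendScalars ι (hopfAction K L H Ω g.val y)) :
    x = y := by
  refine eq_of_forall_extendScalars_eq fun σ => ?_
  obtain ⟨g, rfl⟩ := (groupLikeEquiv hH ι).surjective σ
  simpa only [extendScalars_hopfAction_groupLike hH] using h g

variable (K H Ω) in
/-- The sum of the grouplike elements: an integral of `Ω ⊗ H`. -/
def groupLikeSum [Fintype (GroupLike Ω (Ω ⊗[K] H))] : Ω ⊗[K] H :=
  ∑ g : GroupLike Ω (Ω ⊗[K] H), g.val

section
variable [Fintype (GroupLike Ω (Ω ⊗[K] H))]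

omit [IsAlgClosed Ω] in
lemma groupLike_mul_groupLikeSum (g : GroupLike Ω (Ω ⊗[K] H)) :
    g.val * groupLikeSum K H Ω = groupLikeSum K H Ω := by
  rw [groupLikeSum, Finset.mul_sum]
  exact Fintype.sum_equiv (Equiv.mulLeft g) _ _ fun x => rfl

omit [IsAlgClosed Ω] in
lemma groupLikeSum_mul_groupLike (g : GroupLike Ω (Ω ⊗[K] H)) :
    groupLikeSum K H Ω * g.val = groupLikeSum K H Ω := by
  rw [groupLikeSum, Finset.sum_mul]
  exact Fintype.sum_equiv (Equiv.mulRight g) _ _ fun x => rfl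

lemma groupLikeSum_ne_zero (hH : IsHopfGalois K L H) : groupLikeSum K H Ω ≠ 0 := by
  intro h
  have := (Fintype.linearIndependent_iff.1
    (groupLikeBasis hH (IsAlgClosed.lift : L →ₐ[K] Ω)).linearIndependent) (fun _ => 1)
    (by simpa [groupLikeSum] using h) 1
  exact one_ne_zero this

/-- The integral acts on `L` through the trace. -/
lemma extendScalars_groupLikeSum (hH : IsHopfGalois K L H) (ι : L →ₐ[K] Ω) (x : L) :
    extendScalars ι (hopfAction K L H Ω (groupLikeSum K H Ω) (1 ⊗ₜ x)) =
      algebraMap K Ω (Algebra.trace K L x) := by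
  rw [groupLikeSum, map_sum, LinearMap.sum_apply, map_sum, trace_eq_sum_embeddings Ω]
  refine Fintype.sum_equiv (groupLikeEquiv hH ι) _ _ fun g => ?_
  rw [extendScalars_hopfAction_groupLike hH, extendScalars_tmul, one_mul]

lemma hopfAction_groupLikeSum_eq_zero_iff (hH : IsHopfGalois K L H) (x : L) :
    hopfAction K L H Ω (groupLikeSum K H Ω) (1 ⊗ₜ x) = 0 ↔ Algebra.trace K L x = 0 := by
  let ι : L →ₐ[K] Ω := IsAlgClosed.lift
  constructor
  · intro h
    have := extendScalars_groupLikeSum hH ι x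
    rw [h, map_zero, eq_comm] at this
    simpa using this
  · intro h
    refine eq_of_forall_extendScalars_groupLike hH ι fun g => ?_
    rw [← Module.End.mul_apply, ← map_mul, groupLike_mul_groupLikeSum,
      extendScalars_groupLikeSum hH ι, h]
    simp
end

end

section
variable {K L H : Type*} [Field K] [Field L] [Algebra K L]
    [Ring H] [HopfAlgebra K H] [Module H L] [IsScalarTower K H L]
    [FiniteDimensional K L] [Algebra.IsSeparable K L]

/-- An element of trace zero is killed by the integral. -/
theorem not_isNormalBasisGenerator_of_trace_eq_zero (hH : IsHopfGalois K L H) {ρ : L}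
    (hρ : Algebra.trace K L ρ = 0) : ¬ IsNormalBasisGenerator H ρ := by
  have := hH.finite_groupLike (Ω := AlgebraicClosure K)
  have := Fintype.ofFinite (GroupLike (AlgebraicClosure K) (AlgebraicClosure K ⊗[K] H))
  rw [isNormalBasisGenerator_iff_injective (Ω := AlgebraicClosure K) hH]
  exact fun h => groupLikeSum_ne_zero hH
    (h _ ((hopfAction_groupLikeSum_eq_zero_iff hH ρ).2 hρ))

/-- In characteristic `p` and degree `p ^ m`, the annihilator of `ρ` in `Ω ⊗ H` is a left ideal, and
is stable under the `p`-group of grouplike elements. If it is nonzero then it contains a nonzero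
element fixed by that group, hence the integral. -/
theorem isNormalBasisGenerator_of_trace_ne_zero (hH : IsHopfGalois K L H) (p : ℕ) [Fact p.Prime]
    [CharP K p] {m : ℕ} (hm : Module.finrank K L = p ^ m) {ρ : L} (hρ : Algebra.trace K L ρ ≠ 0) :
    IsNormalBasisGenerator H ρ := by
  set Ω := AlgebraicClosure K
  have := hH.finite_groupLike (Ω := Ω)
  have := Fintype.ofFinite (GroupLike Ω (Ω ⊗[K] H))
  let ι : L →ₐ[K] Ω := IsAlgClosed.lift
  rw [isNormalBasisGenerator_iff_injective (Ω := Ω) hH]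
  by_contra hcon
  push Not at hcon
  obtain ⟨a, ha, ha0⟩ := hcon
  have hp : IsPGroup p (GroupLike Ω (Ω ⊗[K] H)) := IsPGroup.of_card (n := m) (by
    rw [hH.card_groupLike, hm])
  let _ : Module (ZMod p) (Ω ⊗[K] H) := AddCommGroup.zmodModule fun x => by
    have : (p : K) = 0 := CharP.cast_eq_zero K p
    rw [← Nat.cast_smul_eq_nsmul K, this, zero_smul]
  let _ : DistribMulAction (GroupLike Ω (Ω ⊗[K] H)) (Ω ⊗[K] H) :=
    DistribMulAction.compHom _ (GroupLike.valMonoidHom (R := Ω) (A := Ω ⊗[K] H))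
  obtain ⟨c, hc, hc0, hcg⟩ := hp.exists_ne_zero_forall_smul_eq
    (LinearMap.ker ((hopfAction K L H Ω).toLinearMap.flip (1 ⊗ₜ ρ))).toAddSubgroup (by
      intro g y hy
      change hopfAction K L H Ω (g.val * y) (1 ⊗ₜ ρ) = 0
      have hy' : hopfAction K L H Ω y (1 ⊗ₜ ρ) = 0 := hy
      rw [map_mul, Module.End.mul_apply, hy', map_zero]) (x := a) ha ha0
  replace hcg : ∀ g : GroupLike Ω (Ω ⊗[K] H), g.val * c = c := hcg
  replace hc : hopfAction K L H Ω c (1 ⊗ₜ ρ) = 0 := hc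
  -- the coefficients of `c` on the basis of grouplike elements are all equal
  set B := groupLikeBasis hH ι with hB
  have hcoef : ∀ g, B.repr c g = B.repr c 1 := by
    intro g
    have h1 : B.repr (g.val * c) g = B.repr c 1 := by
      conv_lhs => rw [← B.sum_repr c]
      rw [Finset.mul_sum, map_sum, Finsupp.finsetSum_apply, Finset.sum_eq_single 1]
      · have : g.val * (B.repr c 1 • B 1) = B.repr c 1 • B g := by
          simp [hB]
        rw [this]; simp
      · intro x _ hx
        have : g.val * (B.repr c x • B x) = B.repr c x • B (g * x) := by
          simp [hB]
        rw [this]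
        simp [hx]
      · simp
    rwa [hcg] at h1
  have hcT : c = B.repr c 1 • groupLikeSum K H Ω := by
    conv_lhs => rw [← B.sum_repr c]
    simp_rw [hcoef, groupLikeSum, Finset.smul_sum]
    simp [hB]
  have hne : B.repr c 1 ≠ 0 := by
    intro h
    rw [h, zero_smul] at hcT
    exact hc0 hcT
  rw [hcT, map_smul, LinearMap.smul_apply, smul_eq_zero, hopfAction_groupLikeSum_eq_zero_iff hH] at hc
  exact hc.elim hne hρ
end

/-! ### The socle away from the constants -/

section
variable {A V : Type*} [Ring A] [AddCommGroup V] [Module A V]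

variable (A) in
/-- The sum of the simple submodules which do not contain `o`. -/
def socleAvoiding (o : V) : Submodule A V := sSup {S | IsSimpleModule A S ∧ o ∉ S}

/-- If `o` spans a simple submodule which contains every element killed by the annihilator of `o`,
then that submodule is not isomorphic to another simple submodule, and so is not contained in the
sum of the others. -/
lemma notMem_socleAvoiding {o : V} (ho : IsSimpleModule A (Submodule.span A {o}))
    (hann : ∀ x : V, (∀ a : A, a • o = 0 → a • x = 0) → x ∈ Submodule.span A {o}) :
    o ∉ socleAvoiding A o := by
  intro h
  have : ∀ m : {S : Submodule A V | IsSimpleModule A S ∧ o ∉ S}, IsSimpleModule A m := fun m => m.2.1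
  obtain ⟨S, ⟨hS, hoS⟩, ⟨e⟩⟩ := Submodule.linearEquiv_of_le_sSup _ _
    ((Submodule.span_singleton_le_iff_mem o _).2 h)
  let o' : Submodule.span A {o} := ⟨o, Submodule.mem_span_singleton_self o⟩
  have ho0 : o ≠ 0 := by
    rintro rfl
    exact hoS S.zero_mem
  have hx0 : (e o' : V) ≠ 0 := by
    intro h
    have : o' = 0 := e.map_eq_zero_iff.1 (Subtype.ext h)
    exact ho0 (congrArg Subtype.val this)
  have hx : (e o' : V) ∈ Submodule.span A {o} := hann _ fun a ha => by
    have : a • o' = 0 := Subtype.ext ha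
    rw [← Submodule.coe_smul, ← map_smul, this, map_zero, Submodule.coe_zero]
  have hle : Submodule.span A {(e o' : V)} ≤ Submodule.span A {o} :=
    (Submodule.span_singleton_le_iff_mem _ _).2 hx
  have heq := ((isSimpleModule_iff_isAtom.1 ho).le_iff_eq
    (by simpa [Submodule.span_singleton_eq_bot] using hx0)).1 hle
  exact hoS ((Submodule.span_singleton_le_iff_mem _ _).2 (e o').2
    (heq.ge (Submodule.mem_span_singleton_self o)))

/-- An additive automorphism which permutes the operators `x ↦ a • x` by conjugation permutes the
submodules. -/
def AddEquiv.submoduleOrderIso (T : V ≃+ V) (h₁ : ∀ a : A, ∃ a' : A, ∀ x, T (a • x) = a' • T x)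
    (h₂ : ∀ a' : A, ∃ a : A, ∀ x, T (a • x) = a' • T x) : Submodule A V ≃o Submodule A V where
  toFun S :=
    { S.toAddSubmonoid.comap T.symm.toAddMonoidHom with
      smul_mem' := fun a' x hx => by
        obtain ⟨a, ha⟩ := h₂ a'
        have : T.symm (a' • x) = a • T.symm x := by rw [AddEquiv.symm_apply_eq, ha]; simp
        change T.symm (a' • x) ∈ S
        rw [this]
        exact S.smul_mem a hx }
  invFun S :=
    { S.toAddSubmonoid.comap T.toAddMonoidHom with
      smul_mem' := fun a x hx => by
        obtain ⟨a', ha⟩ := h₁ a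
        change T (a • x) ∈ S
        rw [ha]
        exact S.smul_mem a' hx }
  left_inv S := by
    ext x
    change T.symm (T x) ∈ S ↔ x ∈ S
    simp
  right_inv S := by
    ext x
    change T (T.symm x) ∈ S ↔ x ∈ S
    simp
  map_rel_iff' {S S'} := by
    constructor
    · intro h x hx
      have : T.symm (T x) ∈ S' := h (show T.symm (T x) ∈ S by simpa using hx)
      simpa using this
    · exact fun h x hx => h hx

lemma map_mem_socleAvoiding {o : V} (T : V ≃+ V)
    (h₁ : ∀ a : A, ∃ a' : A, ∀ x, T (a • x) = a' • T x)
    (h₂ : ∀ a' : A, ∃ a : A, ∀ x, T (a • x) = a' • T x) (ho : T o = o) {x : V}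
    (hx : x ∈ socleAvoiding A o) : T x ∈ socleAvoiding A o := by
  set f := T.submoduleOrderIso h₁ h₂ with hf
  have hmem : ∀ (S : Submodule A V) y, y ∈ f S ↔ T.symm y ∈ S := fun S y => Iff.rfl
  have h : f (socleAvoiding A o) ≤ socleAvoiding A o := by
    rw [socleAvoiding, f.map_sSup]
    refine iSup₂_le fun S hS => le_sSup ⟨?_, ?_⟩
    · rw [isSimpleModule_iff_isAtom, f.isAtom_iff, ← isSimpleModule_iff_isAtom]
      exact hS.1
    · rw [hmem, (AddEquiv.symm_apply_eq T).2 ho.symm]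
      exact hS.2
  exact h ((hmem _ _).2 (by simpa using hx))
end

noncomputable section
variable {K L H Ω : Type*} [Field K] [Field L] [Algebra K L]
    [Ring H] [HopfAlgebra K H] [Module H L] [IsScalarTower K H L] [Field Ω] [Algebra K Ω]

variable (K L H Ω) in
/-- `Ω ⊗ L` as a module over `Ω ⊗ H`. -/
@[reducible]
def hopfModule : Module (Ω ⊗[K] H) (Ω ⊗[K] L) :=
  Module.compHom _ (hopfAction K L H Ω).toRingHom

attribute [local instance] hopfModule

lemma hopfModule_smul_def (a : Ω ⊗[K] H) (x : Ω ⊗[K] L) : a • x = hopfAction K L H Ω a x := rfl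

instance : IsScalarTower Ω (Ω ⊗[K] H) (Ω ⊗[K] L) where
  smul_assoc ω a x := by simp [hopfModule_smul_def]

variable (K L H Ω) in
/-- The sum of the simple `Ω ⊗ H`-submodules of `Ω ⊗ L` other than that of the constants. -/
def hopfSocle : Submodule (Ω ⊗[K] H) (Ω ⊗[K] L) := socleAvoiding (Ω ⊗[K] H) 1

lemma hopfSocle_galois_stable (γ : Ω ≃ₐ[K] Ω) {x : Ω ⊗[K] L} (hx : x ∈ hopfSocle K L H Ω) :
    TensorProduct.congr γ.toLinearEquiv (LinearEquiv.refl K L) x ∈ hopfSocle K L H Ω := by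
  have key : ∀ (γ : Ω ≃ₐ[K] Ω) (a : Ω ⊗[K] H) (x : Ω ⊗[K] L),
      TensorProduct.congr γ.toLinearEquiv (LinearEquiv.refl K L) (a • x) =
        TensorProduct.congr γ.toLinearEquiv (LinearEquiv.refl K H) a •
          TensorProduct.congr γ.toLinearEquiv (LinearEquiv.refl K L) x := by
    intro γ a x
    induction a with
    | zero => simp
    | add a b ha hb => rw [add_smul, map_add, ha, hb, map_add, add_smul]
    | tmul ω h =>
    induction x with
    | zero => simp
    | add x y hx hy => rw [smul_add, map_add, hx, hy, map_add, smul_add]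
    | tmul ω' x => simp [hopfModule_smul_def]
  refine map_mem_socleAvoiding
    (TensorProduct.congr γ.toLinearEquiv (LinearEquiv.refl K L)).toAddEquiv
    (fun a => ⟨_, key γ a⟩) (fun a => ?_) ?_ hx
  · refine ⟨TensorProduct.congr γ.symm.toLinearEquiv (LinearEquiv.refl K H) a, fun x => ?_⟩
    refine (key γ _ x).trans ?_
    congr 1
    induction a with
    | zero => simp
    | add a b ha hb => rw [map_add, map_add, ha, hb]
    | tmul ω h => simp
  · simp [Algebra.TensorProduct.one_def]

variable [FiniteDimensional K L] [IsAlgClosed Ω] [Algebra.IsSeparable K L]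

lemma IsHopfGalois.groupLike_induction (hH : IsHopfGalois K L H) (motive : Ω ⊗[K] H → Prop)
    (zero : motive 0) (add : ∀ a b, motive a → motive b → motive (a + b))
    (smul : ∀ (ω : Ω) (g : GroupLike Ω (Ω ⊗[K] H)), motive (ω • g.val)) (a : Ω ⊗[K] H) :
    motive a := by
  have := hH.finite_groupLike (Ω := Ω)
  have := Fintype.ofFinite (GroupLike Ω (Ω ⊗[K] H))
  rw [← (groupLikeBasis hH IsAlgClosed.lift).sum_repr a]
  refine Finset.sum_induction _ motive add zero fun g _ => ?_
  rw [groupLikeBasis_apply]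
  exact smul _ g

lemma bijective_pow_tensorProduct (p : ℕ) [Fact p.Prime] [CharP Ω p] [CharP (Ω ⊗[K] L) p] :
    Function.Bijective (frobenius (Ω ⊗[K] L) p) := by
  constructor
  · intro x y h
    refine eq_of_forall_extendScalars_eq fun σ => frobenius_inj Ω p ?_
    rw [frobenius_def, frobenius_def, ← map_pow, ← map_pow]
    exact congrArg _ h
  · intro y
    choose f hf using fun σ : L →ₐ[K] Ω => surjective_frobenius Ω p (extendScalars σ y)
    obtain ⟨x, hx⟩ := exists_forall_extendScalars_eq f
    refine ⟨x, eq_of_forall_extendScalars_eq fun σ => ?_⟩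
    rw [frobenius_def, map_pow, hx, ← frobenius_def, hf]

/-- Grouplike elements commute with the Frobenius map, which thus permutes the submodules of
`Ω ⊗ L`. -/
lemma hopfSocle_pow_mem (hH : IsHopfGalois K L H) (p : ℕ) [Fact p.Prime] [CharP Ω p]
    [CharP (Ω ⊗[K] L) p] {x : Ω ⊗[K] L} (hx : x ∈ hopfSocle K L H Ω) :
    x ^ p ∈ hopfSocle K L H Ω := by
  let F := RingEquiv.ofBijective (frobenius (Ω ⊗[K] L) p) (bijective_pow_tensorProduct p)
  have hF : ∀ y, F y = y ^ p := fun y => rfl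
  have hg : ∀ (g : GroupLike Ω (Ω ⊗[K] H)) y, F (g.val • y) = g.val • F y := fun g y =>
    (map_pow (g.toAlgHom hH.moduleAlgebra) y p).symm
  have hω : ∀ (ω : Ω) (y : Ω ⊗[K] L), F (ω • y) = ω ^ p • F y := fun ω y => by
    rw [hF, hF, smul_pow]
  refine map_mem_socleAvoiding F.toAddEquiv (fun a => ?_) (fun a => ?_) (one_pow p) hx
  · change ∃ a' : Ω ⊗[K] H, ∀ x, F (a • x) = a' • F x
    refine hH.groupLike_induction (fun a => ∃ a' : Ω ⊗[K] H, ∀ x, F (a • x) = a' • F x) ?_ ?_ ?_ a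
    · exact ⟨0, fun x => by simp⟩
    · rintro a b ⟨a', ha⟩ ⟨b', hb⟩
      exact ⟨a' + b', fun x => by rw [add_smul, map_add, ha, hb, add_smul]⟩
    · intro ω g
      exact ⟨ω ^ p • g.val, fun x => by rw [smul_assoc, hω, hg, smul_assoc]⟩
  · change ∃ a' : Ω ⊗[K] H, ∀ x, F (a' • x) = a • F x
    refine hH.groupLike_induction (fun a => ∃ a' : Ω ⊗[K] H, ∀ x, F (a' • x) = a • F x) ?_ ?_ ?_ a
    · exact ⟨0, fun x => by simp⟩
    · rintro a b ⟨a', ha⟩ ⟨b', hb⟩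
      exact ⟨a' + b', fun x => by rw [add_smul, map_add, ha, hb, add_smul]⟩
    · intro ω g
      obtain ⟨ω', rfl⟩ := surjective_frobenius Ω p ω
      exact ⟨ω' • g.val, fun x => by rw [smul_assoc, hω, hg, smul_assoc, frobenius_def]⟩

lemma one_notMem_hopfSocle (hH : IsHopfGalois K L H) : (1 : Ω ⊗[K] L) ∉ hopfSocle K L H Ω := by
  let ι : L →ₐ[K] Ω := IsAlgClosed.lift
  have hone : ∀ a : Ω ⊗[K] H, a • (1 : Ω ⊗[K] L) = Coalgebra.counit (R := Ω) a • 1 :=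
    hopfAction_one hH.moduleAlgebra
  have h10 : (1 : Ω ⊗[K] L) ≠ 0 := by
    intro h
    have := congrArg (extendScalars ι) h
    simp at this
  have hmem : ∀ ω : Ω, ω • (1 : Ω ⊗[K] L) ∈ Submodule.span (Ω ⊗[K] H) {(1 : Ω ⊗[K] L)} := fun ω =>
    Submodule.mem_span_singleton.2 ⟨algebraMap Ω _ ω, by
      rw [hopfModule_smul_def, AlgHom.commutes, Module.algebraMap_end_apply]⟩
  refine notMem_socleAvoiding ?_ fun x hx => ?_
  · have : Nontrivial (Submodule.span (Ω ⊗[K] H) {(1 : Ω ⊗[K] L)}) :=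
      ⟨⟨1, Submodule.mem_span_singleton_self _⟩, 0, fun h => h10 (congrArg Subtype.val h)⟩
    rw [isSimpleModule_iff_isAtom]
    refine ⟨by simp [h10], fun S hS => ?_⟩
    by_contra hS0
    obtain ⟨x, hxS, hx0⟩ := Submodule.exists_mem_ne_zero_of_ne_bot hS0
    obtain ⟨a, rfl⟩ := Submodule.mem_span_singleton.1 (hS.le hxS)
    rw [hone] at hxS hx0
    have hc : Coalgebra.counit (R := Ω) a ≠ 0 := fun h => hx0 (by rw [h, zero_smul])
    refine hS.not_ge ((Submodule.span_singleton_le_iff_mem _ _).2 ?_)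
    have := S.smul_of_tower_mem (Coalgebra.counit (R := Ω) a)⁻¹ hxS
    rwa [smul_smul, inv_mul_cancel₀ hc, one_smul] at this
  · -- an element killed by the annihilator of `1` is fixed by the grouplike elements
    have hfix : ∀ g : GroupLike Ω (Ω ⊗[K] H), hopfAction K L H Ω g.val x = x := by
      intro g
      have := hx (g.val - 1) (by rw [sub_smul, one_smul, hone, g.2.counit_eq_one, one_smul, sub_self])
      rwa [sub_smul, one_smul, sub_eq_zero] at this
    have : x = extendScalars ι x • 1 := by
      refine eq_of_forall_extendScalars_groupLike hH ι fun g => ?_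
      rw [hfix, map_smul, map_smul, ← hopfModule_smul_def, hone, g.2.counit_eq_one]
      simp
    rw [this]
    exact hmem _

/-- If the degree is divisible by a prime `q ≠ p`, the group of grouplike elements contains a
subgroup of order `q`, whose normalised sum is an idempotent `e ≠ 1` fixing the integral. As
`Ω ⊗ L` is free over `Ω ⊗ H`, the left ideal of `1 - e` gives rise to a submodule which does not
contain `1`. -/
lemma hopfSocle_ne_bot (hH : IsHopfGalois K L H) {q : ℕ} [Fact q.Prime]
    (hq : q ∣ Module.finrank K L) (hqΩ : (q : Ω) ≠ 0) : hopfSocle K L H Ω ≠ ⊥ := by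
  classical
  have := hH.finite_groupLike (Ω := Ω)
  have := Fintype.ofFinite (GroupLike Ω (Ω ⊗[K] H))
  let ι : L →ₐ[K] Ω := IsAlgClosed.lift
  obtain ⟨g, hg⟩ := exists_prime_orderOf_dvd_card' (G := GroupLike Ω (Ω ⊗[K] H)) q
    (by rwa [hH.card_groupLike])
  set T := groupLikeSum K H Ω with hT
  set B := groupLikeBasis hH ι with hB
  set P : Ω ⊗[K] H := ∑ i ∈ Finset.range q, (g ^ i).val with hP
  have hTpow : ∀ i : ℕ, T * (g ^ i).val = T := fun i => groupLikeSum_mul_groupLike _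
  have hTP : T * P = (q : Ω) • T := by
    rw [hP, Finset.mul_sum, Finset.sum_congr rfl fun i _ => hTpow i, Finset.sum_const,
      Finset.card_range, Nat.cast_smul_eq_nsmul]
  have hgP : g.val * P = P := by
    have h1 : P = ∑ i ∈ Finset.range q, (g ^ (i + 1)).val := by
      have h2 := Finset.sum_range_succ (fun i => (g ^ i).val) q
      rw [Finset.sum_range_succ' (fun i => (g ^ i).val) q, ← hg, pow_orderOf_eq_one, pow_zero] at h2
      rw [hP, ← hg]
      exact (add_right_cancel h2).symm
    conv_rhs => rw [h1]
    rw [hP, Finset.mul_sum]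
    exact Finset.sum_congr rfl fun i _ => by rw [pow_succ', GroupLike.val_mul]
  have hPP : P * P = (q : Ω) • P := by
    have hpow : ∀ i : ℕ, (g ^ i).val * P = P := by
      intro i
      induction i with
      | zero => simp
      | succ i ih => rw [pow_succ, GroupLike.val_mul, mul_assoc, hgP, ih]
    conv_lhs => rw [hP, Finset.sum_mul, ← hP, Finset.sum_congr rfl fun i _ => hpow i]
    rw [Finset.sum_const, Finset.card_range, Nat.cast_smul_eq_nsmul]
  set f : Ω ⊗[K] H := 1 - (q : Ω)⁻¹ • P with hf
  have hTf : T * f = 0 := by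
    rw [hf, mul_sub, mul_one, mul_smul_comm, hTP, smul_smul, inv_mul_cancel₀ hqΩ, one_smul, sub_self]
  have hff : f * f = f := by
    have : ((q : Ω)⁻¹ • P) * ((q : Ω)⁻¹ • P) = (q : Ω)⁻¹ • P := by
      rw [smul_mul_smul_comm, hPP, smul_smul, mul_assoc, inv_mul_cancel₀ hqΩ, mul_one]
    rw [hf, sub_mul, mul_sub, mul_sub, this]
    simp
  have hf0 : f ≠ 0 := by
    intro h
    have hP1 : P = (q : Ω) • 1 := by
      rw [hf, sub_eq_zero] at h
      rw [h, smul_smul, mul_inv_cancel₀ hqΩ, one_smul]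
    rw [hP1, mul_smul_comm, mul_one] at hgP
    have hg1 : g = 1 := GroupLike.val_injective (by simpa [hqΩ] using hgP)
    rw [hg1, orderOf_one] at hg
    exact (Fact.out : q.Prime).ne_one hg.symm
  -- an element `δ` generating `Ω ⊗ L`, the indicator of `1` on the group of grouplike elements
  obtain ⟨δ, hδ⟩ : ∃ δ : Ω ⊗[K] L, ∀ g : GroupLike Ω (Ω ⊗[K] H),
      extendScalars ι (hopfAction K L H Ω g.val δ) = if g = 1 then 1 else 0 := by
    obtain ⟨δ, hδ⟩ := exists_forall_extendScalars_eq
      (fun σ : L →ₐ[K] Ω => if (groupLikeEquiv hH ι).symm σ = 1 then (1 : Ω) else 0)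
    refine ⟨δ, fun g => ?_⟩
    rw [extendScalars_hopfAction_groupLike hH, hδ, Equiv.symm_apply_apply]
  have hδa : ∀ a (h : GroupLike Ω (Ω ⊗[K] H)),
      extendScalars ι (hopfAction K L H Ω (h⁻¹.val * a) δ) = B.repr a h := by
    intro a h
    conv_lhs => rw [← B.sum_repr a]
    rw [Finset.mul_sum, map_sum, LinearMap.sum_apply, map_sum, Finset.sum_eq_single h]
    · have : h⁻¹.val * B.repr a h • B h = B.repr a h • (h⁻¹ * h).val := by
        rw [mul_smul_comm, hB, groupLikeBasis_apply, GroupLike.val_mul]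
      rw [this, map_smul, LinearMap.smul_apply, map_smul, hδ, inv_mul_cancel, if_pos rfl, smul_eq_mul,
        mul_one]
    · intro x _ hx
      have : h⁻¹.val * B.repr a x • B x = B.repr a x • (h⁻¹ * x).val := by
        rw [mul_smul_comm, hB, groupLikeBasis_apply, GroupLike.val_mul]
      rw [this, map_smul, LinearMap.smul_apply, map_smul, hδ, if_neg, smul_zero]
      rw [inv_mul_eq_one]
      exact fun h => hx h.symm
    · simp
  have hδ0 : ∀ a : Ω ⊗[K] H, a • δ = 0 → a = 0 := by
    intro a ha
    rw [← B.repr.map_eq_zero_iff]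
    ext h
    rw [← hδa, map_mul, Module.End.mul_apply, ← hopfModule_smul_def a, ha]
    simp
  have hTδ : T • δ = 1 := by
    refine eq_of_forall_extendScalars_groupLike hH ι fun x => ?_
    have h1 := hδa T x⁻¹
    rw [inv_inv] at h1
    rw [hopfModule_smul_def, ← Module.End.mul_apply, ← map_mul, h1, hopfAction_one hH.moduleAlgebra,
      x.2.counit_eq_one, one_smul, map_one, hT, groupLikeSum, map_sum, Finsupp.finsetSum_apply,
      Finset.sum_eq_single x⁻¹]
    · rw [← groupLikeBasis_apply hH ι, ← hB]; simp
    · intro y _ hy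
      rw [← groupLikeBasis_apply hH ι, ← hB]; simp [hy]
    · simp
  have : IsArtinian (Ω ⊗[K] H) (Ω ⊗[K] L) := isArtinian_of_tower Ω inferInstance
  obtain hbot | ⟨S, hS, hle⟩ := eq_bot_or_exists_atom_le (Submodule.span (Ω ⊗[K] H) {f • δ})
  · rw [Submodule.span_singleton_eq_bot] at hbot
    exact absurd (hδ0 f hbot) hf0
  · refine ne_bot_of_le_ne_bot hS.1 (le_sSup ⟨isSimpleModule_iff_isAtom.2 hS, fun h1 => ?_⟩)
    obtain ⟨a, ha⟩ := Submodule.mem_span_singleton.1 (hle h1)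
    have hTaf : a * f = T := by
      rw [← sub_eq_zero]
      refine hδ0 _ ?_
      rw [sub_smul, mul_smul, ha, hTδ, sub_self]
    refine groupLikeSum_ne_zero (Ω := Ω) hH ?_
    rw [← hT, ← hTaf, ← hff, ← mul_assoc, hTaf, hTf]

end

/-! ### Descent of the socle to the field -/

lemma exists_pow_mem_range_of_forall_algEquiv_apply_eq {K : Type*} [Field K] (p : ℕ) [ExpChar K p]
    {c : AlgebraicClosure K} (hc : ∀ γ : AlgebraicClosure K ≃ₐ[K] AlgebraicClosure K, γ c = c) :
    ∃ k : ℕ, c ^ p ^ k ∈ (algebraMap K (AlgebraicClosure K)).range := by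
  classical
  have hint : IsIntegral K c := Algebra.IsIntegral.isIntegral c
  rw [← minpoly.natSepDegree_eq_one_iff_pow_mem p,
    Polynomial.natSepDegree_eq_of_isAlgClosed (AlgebraicClosure K), Finset.card_eq_one]
  refine ⟨c, Finset.ext fun d => ?_⟩
  rw [Multiset.mem_toFinset, Finset.mem_singleton, ← isConjRoot_iff_mem_minpoly_aroots hint,
    isConjRoot_iff_exists_algEquiv]
  constructor
  · rintro ⟨γ, hγ⟩
    rw [← hc γ] at hγ
    exact γ.injective hγ
  · rintro rfl
    exact ⟨1, rfl⟩

noncomputable section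
variable {K L H : Type*} [Field K] [Field L] [Algebra K L]
    [Ring H] [HopfAlgebra K H] [Module H L] [IsScalarTower K H L]
    [FiniteDimensional K L] [Algebra.IsSeparable K L]

attribute [local instance] hopfModule

/-- Descent of the socle to `L`: an element with as few nonzero coordinates as possible, one of them
equal to `1`, is fixed by the automorphisms of the algebraic closure, and so it is mapped into `L` by
a power of the Frobenius map. -/
lemma exists_tmul_mem_hopfSocle (hH : IsHopfGalois K L H) (p : ℕ) [Fact p.Prime] [CharP K p]
    (hS : hopfSocle K L H (AlgebraicClosure K) ≠ ⊥) :
    ∃ y : L, y ≠ 0 ∧ (1 : AlgebraicClosure K) ⊗ₜ[K] y ∈ hopfSocle K L H (AlgebraicClosure K) := by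
  classical
  set Ω := AlgebraicClosure K
  have : CharP Ω p := charP_of_injective_algebraMap (algebraMap K Ω).injective p
  have : CharP (Ω ⊗[K] L) p := charP_of_injective_algebraMap (algebraMap Ω (Ω ⊗[K] L)).injective p
  set B := Module.finBasis K L
  set B' := B.baseChange Ω with hB'
  obtain ⟨x₀, hx₀S, hx₀⟩ := Submodule.exists_mem_ne_zero_of_ne_bot hS
  obtain ⟨x, ⟨hxS, hx⟩, hmin⟩ := WellFounded.has_min
    (measure fun x : Ω ⊗[K] L => (B'.repr x).support.card).wf
    {x | x ∈ hopfSocle K L H Ω ∧ x ≠ 0} ⟨x₀, hx₀S, hx₀⟩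
  obtain ⟨i, hi⟩ : ∃ i, B'.repr x i ≠ 0 := by
    by_contra hcon
    push Not at hcon
    exact hx (B'.repr.map_eq_zero_iff.1 (Finsupp.ext hcon))
  set c := (B'.repr x i)⁻¹ • x with hc
  have hcS : c ∈ hopfSocle K L H Ω := Submodule.smul_of_tower_mem _ _ hxS
  have hci : B'.repr c i = 1 := by simp [hc, hi]
  have hc0 : c ≠ 0 := smul_ne_zero (inv_ne_zero hi) hx
  have hγcoord : ∀ (γ : Ω ≃ₐ[K] Ω) (z : Ω ⊗[K] L) j,
      B'.repr (TensorProduct.congr γ.toLinearEquiv (LinearEquiv.refl K L) z) j =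
        γ (B'.repr z j) := by
    intro γ z j
    induction z with
    | zero => simp
    | add z z' hz hz' => simp [hz, hz']
    | tmul ω l => simp [hB', Module.Basis.baseChange_repr_tmul]
  have hfix : ∀ (γ : Ω ≃ₐ[K] Ω) j, γ (B'.repr c j) = B'.repr c j := by
    intro γ j
    set d := TensorProduct.congr γ.toLinearEquiv (LinearEquiv.refl K L) c - c with hd
    have hdj : ∀ j, B'.repr d j = γ (B'.repr c j) - B'.repr c j := fun j => by
      rw [hd, map_sub, Finsupp.sub_apply, hγcoord]
    suffices d = 0 by
      rw [← sub_eq_zero, ← hdj, this]; simp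
    by_contra hd0
    refine hmin d ⟨Submodule.sub_mem _ (hopfSocle_galois_stable γ hcS) hcS, hd0⟩
      (Finset.card_lt_card ((Finset.ssubset_iff_of_subset ?_).2 ⟨i, ?_, ?_⟩))
    · intro j hj
      rw [Finsupp.mem_support_iff, hdj] at hj
      rw [Finsupp.mem_support_iff]
      intro h0
      refine hj ?_
      simp [hc, h0]
    · simpa using hi
    · rw [Finsupp.mem_support_iff, hdj, hci]; simp
  choose k hk using fun j => exists_pow_mem_range_of_forall_algEquiv_apply_eq (K := K) p
    (fun γ => hfix γ j)
  set N := Finset.univ.sup k with hN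
  have hkN : ∀ j, ∃ a : K, algebraMap K Ω a = B'.repr c j ^ p ^ N := by
    intro j
    obtain ⟨a, ha⟩ := hk j
    have hle : k j ≤ N := Finset.le_sup (Finset.mem_univ j)
    refine ⟨a ^ p ^ (N - k j), ?_⟩
    rw [map_pow, ha, ← pow_mul, ← pow_add, Nat.add_sub_cancel' hle]
  choose a ha using hkN
  have hpow : ∀ m : ℕ, c ^ p ^ m ∈ hopfSocle K L H Ω ∧ c ^ p ^ m ≠ 0 := by
    intro m
    induction m with
    | zero => simpa using ⟨hcS, hc0⟩
    | succ m ih =>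
      rw [pow_succ, pow_mul]
      refine ⟨hopfSocle_pow_mem hH p ih.1, fun h0 => ih.2 ?_⟩
      refine (bijective_pow_tensorProduct (K := K) (L := L) (Ω := Ω) p).1 ?_
      rw [frobenius_def, h0, map_zero]
  have heq : c ^ p ^ N = 1 ⊗ₜ (∑ j, a j • B j ^ p ^ N) := by
    conv_lhs => rw [← B'.sum_repr c]
    rw [sum_pow_char_pow, TensorProduct.tmul_sum]
    refine Finset.sum_congr rfl fun j _ => ?_
    rw [smul_pow, ← ha, hB', Module.Basis.baseChange_apply, Algebra.TensorProduct.tmul_pow, one_pow,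
      TensorProduct.tmul_smul, algebraMap_smul]
  refine ⟨∑ j, a j • B j ^ p ^ N, ?_, heq ▸ (hpow N).1⟩
  intro h0
  rw [h0, TensorProduct.tmul_zero] at heq
  exact (hpow N).2 heq

/-- If the degree is divisible by a prime `q ≠ p`, some Frobenius-stable subspace `W` of `L` avoids
`1` while its orthogonal complement consists of non-generators. Indeed `W` is nonzero and stable
under `H`, and grouplike elements are isometries of the trace form, so if `ρ` is orthogonal to `W`
then so is every element of `H • ρ`, and this is not all of `L`. -/
theorem exists_frobenius_stable_submodule (hH : IsHopfGalois K L H) (p : ℕ) [Fact p.Prime]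
    [CharP K p] {q : ℕ} (hqp : q.Prime) (hne : q ≠ p) (hq : q ∣ Module.finrank K L) :
    ∃ W : Submodule K L, (1 : L) ∉ W ∧ (∀ x ∈ W, x ^ p ∈ W) ∧
      ∀ ρ : L, (∀ y ∈ W, Algebra.trace K L (ρ * y) = 0) → ¬ IsNormalBasisGenerator H ρ := by
  set Ω := AlgebraicClosure K
  have : CharP Ω p := charP_of_injective_algebraMap (algebraMap K Ω).injective p
  have : CharP (Ω ⊗[K] L) p := charP_of_injective_algebraMap (algebraMap Ω (Ω ⊗[K] L)).injective p
  have : Fact q.Prime := ⟨hqp⟩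
  have hqΩ : (q : Ω) ≠ 0 := by
    rw [Ne, CharP.cast_eq_zero_iff Ω p, Nat.prime_dvd_prime_iff_eq Fact.out hqp]
    exact hne.symm
  obtain ⟨y, hy0, hy⟩ := exists_tmul_mem_hopfSocle hH p (hopfSocle_ne_bot hH hq hqΩ)
  let W : Submodule K L :=
    (((hopfSocle K L H Ω).restrictScalars Ω).restrictScalars K).comap (TensorProduct.mk K Ω L 1)
  have hmemW : ∀ x : L, x ∈ W ↔ (1 : Ω) ⊗ₜ[K] x ∈ hopfSocle K L H Ω := fun x => Iff.rfl
  have hWH : ∀ (h : H), ∀ x ∈ W, h • x ∈ W := by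
    intro h x hx
    have := (hopfSocle K L H Ω).smul_mem (1 ⊗ₜ h) ((hmemW x).1 hx)
    rwa [hopfModule_smul_def, hopfAction_tmul, one_mul, ← hmemW] at this
  refine ⟨W, ?_, ?_, ?_⟩
  · rw [hmemW, ← Algebra.TensorProduct.one_def]
    exact one_notMem_hopfSocle hH
  · intro x hx
    have := hopfSocle_pow_mem hH p ((hmemW x).1 hx)
    rwa [Algebra.TensorProduct.tmul_pow, one_pow, ← hmemW] at this
  · intro ρ hρ hgen
    have := hH.finite_groupLike (Ω := Ω)
    have := Fintype.ofFinite (GroupLike Ω (Ω ⊗[K] H))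
    have := hH.finiteDimensional
    let ι : L →ₐ[K] Ω := IsAlgClosed.lift
    -- the trace form of `Ω ⊗ L` over `Ω`
    let t : Ω ⊗[K] L →ₗ[Ω] Ω :=
      (extendScalars ι).toLinearMap.comp (hopfAction K L H Ω (groupLikeSum K H Ω))
    have ht : ∀ x : L, t (1 ⊗ₜ x) = algebraMap K Ω (Algebra.trace K L x) := fun x =>
      extendScalars_groupLikeSum hH ι x
    have htg : ∀ (g : GroupLike Ω (Ω ⊗[K] H)) z, t (hopfAction K L H Ω g.val z) = t z := fun g z => by
      simp only [t, LinearMap.comp_apply]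
      rw [← Module.End.mul_apply, ← map_mul, groupLikeSum_mul_groupLike]
    have horth : ∀ a : Ω ⊗[K] H, t (1 ⊗ₜ ρ * hopfAction K L H Ω a (1 ⊗ₜ y)) = 0 := by
      intro a
      induction a with
      | zero => simp
      | add a b ha hb => rw [map_add, LinearMap.add_apply, mul_add, map_add, ha, hb, add_zero]
      | tmul ω h =>
        have : (1 ⊗ₜ ρ * hopfAction K L H Ω (ω ⊗ₜ h) (1 ⊗ₜ y) : Ω ⊗[K] L) =
            ω • (1 ⊗ₜ (ρ * h • y)) := by
          rw [hopfAction_tmul, Algebra.TensorProduct.tmul_mul_tmul, TensorProduct.smul_tmul']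
          simp
        rw [this, map_smul, ht, hρ _ (hWH h y hy)]
        simp
    have hgorth : ∀ a : Ω ⊗[K] H, t (hopfAction K L H Ω a (1 ⊗ₜ ρ) * 1 ⊗ₜ y) = 0 := by
      intro a
      refine hH.groupLike_induction
        (fun a => t (hopfAction K L H Ω a (1 ⊗ₜ ρ) * 1 ⊗ₜ y) = 0) ?_ ?_ ?_ a
      · simp
      · intro a b ha hb
        rw [map_add, LinearMap.add_apply, add_mul, map_add, ha, hb, add_zero]
      · intro ω g
        rw [map_smul, LinearMap.smul_apply, smul_mul_assoc, map_smul, ← htg g⁻¹]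
        have : hopfAction K L H Ω g⁻¹.val (hopfAction K L H Ω g.val (1 ⊗ₜ ρ) * 1 ⊗ₜ y) =
            1 ⊗ₜ ρ * hopfAction K L H Ω g⁻¹.val (1 ⊗ₜ y) := by
          have hmul := map_mul (g⁻¹.toAlgHom hH.moduleAlgebra)
            (hopfAction K L H Ω g.val (1 ⊗ₜ ρ)) (1 ⊗ₜ y)
          refine hmul.trans ?_
          congr 1
          change hopfAction K L H Ω g⁻¹.val (hopfAction K L H Ω g.val (1 ⊗ₜ ρ)) = _
          rw [← Module.End.mul_apply, ← map_mul, ← GroupLike.val_mul, inv_mul_cancel,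
            GroupLike.val_one, map_one, Module.End.one_apply]
        rw [this, horth, smul_zero]
    have hsurj : Function.Surjective ((hopfAction K L H Ω).toLinearMap.flip (1 ⊗ₜ[K] ρ)) := by
      rw [← LinearMap.injective_iff_surjective_of_finrank_eq_finrank (by
        rw [Module.finrank_baseChange, Module.finrank_baseChange, hH.finrank_eq]),
        injective_iff_map_eq_zero]
      exact (isNormalBasisGenerator_iff_injective hH).1 hgen
    obtain ⟨z, hz⟩ := Algebra.trace_surjective K L 1
    obtain ⟨a, ha⟩ := hsurj (1 ⊗ₜ (z * y⁻¹))
    have h0 := hgorth a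
    have ha' : hopfAction K L H Ω a (1 ⊗ₜ ρ) = 1 ⊗ₜ (z * y⁻¹) := ha
    rw [ha', Algebra.TensorProduct.tmul_mul_tmul, one_mul, inv_mul_cancel_right₀ hy0, ht, hz,
      map_one] at h0
    exact one_ne_zero h0
end

/-! ### Existence of generators and non-generators by valuation -/

/-- With a totally ramified extension of degree divisible by a prime `q ≠ p`, non-generators exist in
the critical class of valuations as well: they are found in the orthogonal complement of a
Frobenius-stable subspace. -/
lemma exists_not_isNormalBasisGenerator_of_prime_dvd {K L H : Type*} [Field K] [Field L]
    [Algebra K L] [Ring H] [HopfAlgebra K H] [Module H L] [IsScalarTower K H L]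
    [FiniteDimensional K L] [Algebra.IsSeparable K L] (hH : IsHopfGalois K L H) (p : ℕ)
    [Fact p.Prime] [CharP K p] {v : Valuation L (WithZero (Multiplicative ℤ))} {w : ℤ}
    (h : IsTraceValuation K v (Module.finrank K L) w)
    (hres : ∀ x : L, v x ≤ 1 → ∃ r : K, v (algebraMap K L r) ≤ 1 ∧ v (x - algebraMap K L r) < 1)
    {q : ℕ} (hqp : q.Prime) (hne : q ≠ p) (hq : q ∣ Module.finrank K L) {i : ℤ}
    (hi : i ≡ w + 1 [ZMOD Module.finrank K L]) :
    ∃ ρ : L, v ρ = WithZero.exp i ∧ ¬ IsNormalBasisGenerator H ρ := by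
  have : CharP L p := charP_of_injective_algebraMap (algebraMap K L).injective p
  have : NeZero (Module.finrank K L) := ⟨Module.finrank_pos.ne'⟩
  obtain ⟨W, hW1, hWp, hW⟩ := exists_frobenius_stable_submodule hH p hqp hne hq
  obtain ⟨ρ, hρ, hρW⟩ :=
    h.exists_trace_mul_eq_zero rfl hres (h.valuation_ne_one p hres hW1 hWp) hi
  exact ⟨ρ, hρ, hW ρ hρW⟩

theorem theorem2 (p : ℕ) [Fact p.Prime]
    (R S K L H : Type*)
    [CommRing R] [IsDomain R] [IsDiscreteValuationRing R] [CharP R p]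
    [CommRing S] [IsDomain S] [IsDiscreteValuationRing S]
    [Algebra R S] [Module.IsTorsionFree R S] [Module.Finite R S]
    [Field K] [Algebra R K] [IsFractionRing R K]
    [Field L] [Algebra S L] [IsFractionRing S L]
    [Algebra K L] [Algebra R L] [IsScalarTower R K L] [IsScalarTower R S L]
    [Algebra.IsSeparable K L]
    [Ring H] [HopfAlgebra K H] [Module H L] [IsScalarTower K H L]
    (hH : IsHopfGalois K L H) (b : ℤ) :
    ((IsTotallyRamified R S K L ∧ (∃ m : ℕ, Module.finrank K L = p ^ m) ∧
        b ≡ -differentValuation R S L - 1 [ZMOD (Module.finrank K L : ℤ)]) →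
      ∀ ρ : L, HasValuation S ρ b → IsNormalBasisGenerator H ρ) ∧
    (((¬ ∃ m : ℕ, Module.finrank K L = p ^ m) ∨ ¬ IsTotallyRamified R S K L ∨
        ¬ b ≡ -differentValuation R S L - 1 [ZMOD (Module.finrank K L : ℤ)]) →
      ∃ ρ : L, HasValuation S ρ b ∧ ¬ IsNormalBasisGenerator H ρ) := by
  have := finiteDimensional_of_isFractionRing R S K L
  have : CharP K p := charP_of_injective_algebraMap (IsFractionRing.injective R K) p
  have h := isTraceValuation_maximalIdeal R S K L
  -- Mathlib's valuation is `exp (-v_L)`, so the critical class is that of `w + 1`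
  have hb : b ≡ -differentValuation R S L - 1 [ZMOD (Module.finrank K L : ℤ)] ↔
      -b ≡ differentValuation R S L + 1 [ZMOD (Module.finrank K L : ℤ)] := by
    rw [← Int.neg_modEq_neg]
    ring_nf
  rw [hb]
  have htrace : (∃ ρ : L, (IsDiscreteValuationRing.maximalIdeal S).valuation L ρ =
      WithZero.exp (-b) ∧ Algebra.trace K L ρ = 0) →
      ∃ ρ : L, HasValuation S ρ b ∧ ¬ IsNormalBasisGenerator H ρ := fun ⟨ρ, hρ, h0⟩ =>
    ⟨ρ, hρ, not_isNormalBasisGenerator_of_trace_eq_zero hH h0⟩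
  by_cases hram : IsTotallyRamified R S K L
  · have hres := hram.exists_valuation_sub_lt
    rw [hram] at h
    refine ⟨fun ⟨_, ⟨m, hm⟩, hi⟩ ρ hρ =>
      isNormalBasisGenerator_of_trace_ne_zero hH p hm (h.trace_ne_zero hres hi hρ), fun hcases => ?_⟩
    by_cases hi : -b ≡ differentValuation R S L + 1 [ZMOD (Module.finrank K L : ℤ)]
    · have hpow : ¬ ∃ m : ℕ, Module.finrank K L = p ^ m := by
        rcases hcases with hcases | hcases | hcases
        exacts [hcases, absurd hram hcases, absurd hi hcases]
      obtain ⟨q, hqp, hq, hne⟩ : ∃ q : ℕ, q.Prime ∧ q ∣ Module.finrank K L ∧ q ≠ p := by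
        by_contra! hcon
        exact hpow ⟨_, Nat.eq_prime_pow_of_unique_prime_dvd Module.finrank_pos.ne'
          fun {d} hd hdvd => hcon d hd hdvd⟩
      exact exists_not_isNormalBasisGenerator_of_prime_dvd hH p h hres hqp hne hq hi
    · exact htrace (h.exists_trace_eq_zero_of_not_modEq hi)
  · obtain ⟨s, hs1, hs⟩ := exists_valuation_sub_eq_one_of_not_isTotallyRamified hram
    exact ⟨fun hc => absurd hc.1 hram,
      fun _ => htrace (h.exists_trace_eq_zero_of_residue hs1 hs (-b))⟩
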